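/- Let $\bar m=(m_i)_{i\ge 1}$ be a sequence of non-negative integers and let $\mathbb T_{\bar m}$ be the spherically homogeneous rooted tree in which every vertex of level $k$ has $m_{k+1}$ children. Its vertices are the words $x_k\cdots x_1$ with $0\le x_i<m_i$, and the children of $v$ are the words $xv$. Let $\operatorname{Aut}(\mathbb T_{\bar m})$ be the group of graph automorphisms fixing the root, acting on the right, $w\mapsto w\cdot g$. For $w$ in the $n$-th level $\mathbb T^n_{\bar m}$, the section $g|_w\in\operatorname{Aut}(\mathbb T_{\sigma^n\bar m})$, where $\sigma^n\bar m=(m_{n+1},m_{n+2},\dots)$, is defined by $(vw)\cdot g=(v\cdot g|_w)(w\cdot g)$. For $G<\operatorname{Aut}(\mathbb T_{\bar m})$, let $G^{(n)}$ be the group generated by all $g|_w$ with $g\in G$, $w\in\mathbb T^n_{\bar m}$. For a discrete probability measure $\nu$ let $H(\nu)=-\sum_{\nu(e)>0}\nu(e)\log\nu(e)\in[0,\infty]$, and for a discrete probability measure $\mu$ on a group let $h(\mu)=\lim_k \frac1k H(\mu^{*k})$. A diagram $(M,P)$ over a group $\Gamma$ and a finite set $Y$ consists of an irreducible stochastic matrix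 $P=(p_{xy})_{x,y\in Y}$ and probability measures $\mu_{xy}$ on $\Gamma$ for the edges with $p_{xy}\neq 0$. The random walk with internal degrees of freedom of $(M,P)$ is the Markov chain $(\mathbf g_k,\mathbf y_k)$ on $\Gamma\times Y$ that moves from $(h,x)$ to $(g,y)$ with probability $p_{xy}\mu_{xy}(h^{-1}g)$. Its asymptotic entropy is $h(M,P)=\lim_k\frac1k H(\mathbf g_k,\mathbf y_k)=\lim_k\frac1k H(\mathbf g_k)$; it is well defined if both limits exist and have one common value for all initial distributions of finite entropy. For non-empty $W\subset Y$, the trace of $(M,P)$ over $W$ is the diagram over $\Gamma$ and $W$ of the walk observed at its successive visits of $\mathbf y_k$ to $W$. **Theorem.** Let $G<\operatorname{Aut}(\mathbb T_{\bar m})$ and let $\mu$ be a (discrete) probability measure on $G$ whose support generates $G$ as a group, with $H(\mu)<\infty$. Let $n\ge 0$, let $\mathbb T_{\bar m}^n=\mathcal O_1\sqcup\dots\sqcup\mathcal O_r$ be the partition of the $n$-th level into $G$-orbits, and let $\mathbb W_i\subset\mathcal O_i$ be non-empty subsets. For each $i$ let $T_{\mathcal O_i}(\mu)$ be the diagram over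 $G^{(n)}$ and $\mathcal O_i$ given by $$p_{vw}=\mu\{g: v\cdot g=w\},\qquad \mu_{vw}(h)=\mu\{g: v\cdot g=w,\ g|_v=h\}/p_{vw}\quad(p_{vw}\ne0),$$ and let the ascension diagram $T_{\mathbb W_i}(\mu)$ be its trace over $\mathbb W_i$. Then the asymptotic entropies $h(\mu)$ and $h(T_{\mathbb W_i}(\mu))$ are well defined and finite, and $$h(\mu)\le\sum_{i=1}^r|\mathbb W_i|\cdot h(T_{\mathbb W_i}(\mu)).$$ -/

import Mathlib

open scoped ENNReal NNReal Topology

namespace RootedTree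

/-! ### Spherically homogeneous rooted trees -/

/-- Here `m k` is the number of children of every vertex of level `k`.  The word
`x_k x_{k-1} … x_1` is the list `[x_k, x_{k-1}, …, x_1]`; its letter `x_i` satisfies
`0 ≤ x_i < m (i - 1)`, and the children of `v` are the words `x :: v`. -/
def IsWord (m : ℕ → ℕ) : List ℕ → Prop
  | [] => True
  | x :: v => x < m v.length ∧ IsWord m v

/-- The vertices of the tree. -/
abbrev Vert (m : ℕ → ℕ) : Type := {w : List ℕ // IsWord m w}

/-- The root, i.e. the empty word. -/
def root (m : ℕ → ℕ) : Vert m := ⟨[], trivial⟩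

/-- The `n`-th level of the tree: the words of length `n`. -/
def level (m : ℕ → ℕ) (n : ℕ) : Set (Vert m) := {v | v.1.length = n}

/-- The tree as a graph: edges join a vertex and its children. -/
def tree (m : ℕ → ℕ) : SimpleGraph (Vert m) where
  Adj v w := (∃ x, w.1 = x :: v.1) ∨ (∃ x, v.1 = x :: w.1)
  symm := ⟨fun _ _ h => h.symm⟩
  loopless := ⟨fun v h => by
    rcases h with ⟨x, h⟩ | ⟨x, h⟩ <;> simpa using congrArg List.length h⟩

/-- `shift n m = σⁿ m`, the sequence of valencies of the subtrees above level `n`. -/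
def shift (n : ℕ) (m : ℕ → ℕ) : ℕ → ℕ := fun k => m (k + n)

/-- Automorphisms of the tree that fix the root. -/
@[ext]
structure TreeAut (m : ℕ → ℕ) where
  toIso : tree m ≃g tree m
  map_root : toIso (root m) = root m

namespace TreeAut

variable {m : ℕ → ℕ}

/-- The right action `w · g`. -/
def act (w : Vert m) (g : TreeAut m) : Vert m := g.toIso w

theorem ext_act {g h : TreeAut m} (H : ∀ w, act w g = act w h) : g = h :=
  TreeAut.ext (RelIso.ext H)

/-- Automorphisms act on the right: `g * h` is `g` followed by `h`. -/
instance : Group (TreeAut m) where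
  mul g h := ⟨g.toIso.trans h.toIso, by
    show h.toIso (g.toIso (root m)) = root m
    rw [g.map_root, h.map_root]⟩
  one := ⟨RelIso.refl _, rfl⟩
  inv g := ⟨g.toIso.symm, by
    show g.toIso.symm (root m) = root m
    rw [RelIso.symm_apply_eq, g.map_root]⟩
  mul_assoc _ _ _ := rfl
  one_mul _ := rfl
  mul_one _ := rfl
  inv_mul_cancel g := ext_act fun w => g.toIso.apply_symm_apply w

theorem act_mul (w : Vert m) (g h : TreeAut m) : act w (g * h) = act (act w g) h := rfl

theorem act_one (w : Vert m) : act w (1 : TreeAut m) = w := rfl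

theorem act_inv_act (w : Vert m) (g : TreeAut m) : act (act w g) g⁻¹ = w :=
  g.toIso.symm_apply_apply w

theorem act_act_inv (w : Vert m) (g : TreeAut m) : act (act w g⁻¹) g = w :=
  g.toIso.apply_symm_apply w

theorem act_injective (g : TreeAut m) : Function.Injective (fun w => act w g) :=
  g.toIso.injective

theorem act_root (g : TreeAut m) : act (root m) g = root m := g.map_root

theorem adj_act (g : TreeAut m) {v w : Vert m} :
    (tree m).Adj (act v g) (act w g) ↔ (tree m).Adj v w := g.toIso.map_rel_iff

/-- Children of `v` are mapped to children of `v · g`. -/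
theorem act_cons (g : TreeAut m) : ∀ (v : List ℕ) (x : ℕ) (hv : IsWord m v)
    (hx : IsWord m (x :: v)), ∃ y, (act ⟨x :: v, hx⟩ g).1 = y :: (act ⟨v, hv⟩ g).1 := by
  intro v
  induction v with
  | nil =>
    intro x hv hx
    have h : (tree m).Adj (act ⟨[], hv⟩ g) (act ⟨[x], hx⟩ g) :=
      (adj_act g).2 (Or.inl ⟨x, rfl⟩)
    rcases h with h | ⟨y, h⟩
    · exact h
    · have hr : act ⟨[], hv⟩ g = root m := act_root g
      rw [hr] at h
      simp [root] at h
  | cons z v ih =>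
    intro x hv hx
    have h : (tree m).Adj (act ⟨z :: v, hv⟩ g) (act ⟨x :: z :: v, hx⟩ g) :=
      (adj_act g).2 (Or.inl ⟨x, rfl⟩)
    rcases h with h | ⟨y, h⟩
    · exact h
    · obtain ⟨y', h'⟩ := ih z hv.2 hv
      rw [h'] at h
      have h2 : act ⟨v, hv.2⟩ g = act ⟨x :: z :: v, hx⟩ g :=
        Subtype.ext (List.cons.inj h).2
      have h3 := congrArg (fun u : Vert m => u.1.length) (act_injective g h2)
      simp at h3
      omega

theorem length_act (g : TreeAut m) : ∀ (v : List ℕ) (hv : IsWord m v),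
    (act ⟨v, hv⟩ g).1.length = v.length := by
  intro v
  induction v with
  | nil => intro hv; exact congrArg (fun u : Vert m => u.1.length) (act_root g)
  | cons x v ih =>
    intro hv
    obtain ⟨y, hy⟩ := act_cons g v x hv.2 hv
    rw [hy, List.length_cons, List.length_cons, ih]

theorem act_mem_level {n : ℕ} {w : Vert m} (hw : w ∈ level m n) (g : TreeAut m) :
    act w g ∈ level m n := (length_act g w.1 w.2).trans hw

end TreeAut

open TreeAut

variable {m : ℕ → ℕ}

theorem isWord_append {n : ℕ} {w : List ℕ} (hw : IsWord m w) (hn : w.length = n) :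
    ∀ v : List ℕ, IsWord m (v ++ w) ↔ IsWord (shift n m) v := by
  intro v
  induction v with
  | nil => simpa [IsWord] using hw
  | cons x v ih =>
    simp only [List.cons_append, IsWord, ih, List.length_append, hn, shift]

/-- The concatenation `vw` of a word `w` of length `n` and a word `v` of the subtree above
level `n`. -/
def concat {n : ℕ} (v : Vert (shift n m)) (w : Vert m) (hw : w ∈ level m n) : Vert m :=
  ⟨v.1 ++ w.1, (isWord_append w.2 hw v.1).2 v.2⟩

theorem exists_concat_act {n : ℕ} (w : Vert m) (hw : w ∈ level m n) (g : TreeAut m) :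
    ∀ (v : List ℕ) (hv : IsWord (shift n m) v), ∃ u : List ℕ, u.length = v.length ∧
      (act (concat ⟨v, hv⟩ w hw) g).1 = u ++ (act w g).1 := by
  intro v
  induction v with
  | nil => intro hv; exact ⟨[], rfl, rfl⟩
  | cons x v ih =>
    intro hv
    obtain ⟨u, hu, h⟩ := ih hv.2
    obtain ⟨y, hy⟩ := act_cons g (v ++ w.1) x ((isWord_append w.2 hw v).2 hv.2)
      ((isWord_append w.2 hw (x :: v)).2 hv)
    refine ⟨y :: u, by simp [hu], ?_⟩
    refine hy.trans ?_
    rw [List.cons_append, ← h]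
    rfl

/-- The word `v · g|_w`: the initial part of `(vw) · g` of the length of `v`. -/
def sectionFun (n : ℕ) (w : Vert m) (hw : w ∈ level m n) (g : TreeAut m)
    (v : Vert (shift n m)) : Vert (shift n m) :=
  ⟨(act (concat v w hw) g).1.take v.1.length, by
    obtain ⟨u, hu, h⟩ := exists_concat_act w hw g v.1 v.2
    have h2 : IsWord m (u ++ (act w g).1) := h ▸ (act (concat v w hw) g).2
    have h3 := (isWord_append (act w g).2 (act_mem_level hw g) u).1 h2
    have h4 : (act (concat v w hw) g).1.take v.1.length = u := by
      rw [h, ← hu, List.take_left]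
    rw [h4]
    exact h3⟩

/-- The defining property of sections: `(vw) · g = (v · g|_w)(w · g)`. -/
theorem concat_sectionFun (n : ℕ) (w : Vert m) (hw : w ∈ level m n) (g : TreeAut m)
    (v : Vert (shift n m)) :
    act (concat v w hw) g = concat (sectionFun n w hw g v) (act w g) (act_mem_level hw g) := by
  obtain ⟨u, hu, h⟩ := exists_concat_act w hw g v.1 v.2
  apply Subtype.ext
  show (act (concat v w hw) g).1
    = (act (concat v w hw) g).1.take v.1.length ++ (act w g).1
  have h4 : (act (concat v w hw) g).1.take v.1.length = u := by
    rw [h, ← hu, List.take_left]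
  rw [h4]
  exact h

theorem concat_injective {n : ℕ} {v v' : Vert (shift n m)} {w : Vert m} {hw : w ∈ level m n}
    (h : concat v w hw = concat v' w hw) : v = v' :=
  Subtype.ext (List.append_cancel_right (congrArg Subtype.val h))

theorem concat_congr {n : ℕ} (v : Vert (shift n m)) {w w' : Vert m} (h : w = w')
    (hw : w ∈ level m n) (hw' : w' ∈ level m n) : concat v w hw = concat v w' hw' := by
  subst h; rfl

theorem adj_concat {n : ℕ} {v v' : Vert (shift n m)} {w : Vert m} (hw : w ∈ level m n) :
    (tree m).Adj (concat v w hw) (concat v' w hw) ↔ (tree (shift n m)).Adj v v' := by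
  show ((∃ x, v'.1 ++ w.1 = x :: (v.1 ++ w.1)) ∨ (∃ x, v.1 ++ w.1 = x :: (v'.1 ++ w.1))) ↔
    ((∃ x, v'.1 = x :: v.1) ∨ (∃ x, v.1 = x :: v'.1))
  simp only [← List.cons_append, List.append_left_inj]

theorem sectionFun_inv (n : ℕ) (w : Vert m) (hw : w ∈ level m n) (g : TreeAut m)
    (v : Vert (shift n m)) :
    sectionFun n (act w g) (act_mem_level hw g) g⁻¹ (sectionFun n w hw g v) = v := by
  have h := concat_sectionFun n (act w g) (act_mem_level hw g) g⁻¹ (sectionFun n w hw g v)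
  rw [← concat_sectionFun n w hw g v, act_inv_act] at h
  rw [concat_congr _ (act_inv_act w g) _ hw] at h
  exact (concat_injective h).symm

theorem sectionFun_inv' (n : ℕ) (w : Vert m) (hw : w ∈ level m n) (g : TreeAut m)
    (v : Vert (shift n m)) :
    sectionFun n w hw g (sectionFun n (act w g) (act_mem_level hw g) g⁻¹ v) = v := by
  have h := concat_sectionFun n w hw g
    (sectionFun n (act w g) (act_mem_level hw g) g⁻¹ v)
  have h1 := concat_sectionFun n (act w g) (act_mem_level hw g) g⁻¹ v
  rw [concat_congr _ (act_inv_act w g) _ hw] at h1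
  rw [← h1, act_act_inv] at h
  exact (concat_injective h).symm

/-- The section `g|_w` of `g` at a vertex `w` of level `n`, an automorphism of the tree with
valencies `σⁿ m`. -/
def sec (n : ℕ) (w : Vert m) (hw : w ∈ level m n) (g : TreeAut m) : TreeAut (shift n m) where
  toIso :=
    { toFun := sectionFun n w hw g
      invFun := sectionFun n (act w g) (act_mem_level hw g) g⁻¹
      left_inv := sectionFun_inv n w hw g
      right_inv := sectionFun_inv' n w hw g
      map_rel_iff' := by
        intro v v'
        show (tree (shift n m)).Adj (sectionFun n w hw g v) (sectionFun n w hw g v') ↔ _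
        rw [← adj_concat (act_mem_level hw g), ← concat_sectionFun, ← concat_sectionFun,
          adj_act, adj_concat] }
  map_root := rfl

/-- The group `G^{(n)}` of `n`-th level sections of `G`: the subgroup generated by all `g|_w`
with `g ∈ G` and `w` in level `n`. -/
def sectionGroup (G : Subgroup (TreeAut m)) (n : ℕ) : Subgroup (TreeAut (shift n m)) :=
  Subgroup.closure {s | ∃ g ∈ G, ∃ (w : Vert m) (hw : w ∈ level m n), s = sec n w hw g}

/-- The orbit of a vertex under the (right) action of `G`. -/
def orbit (G : Subgroup (TreeAut m)) (v : Vert m) : Set (Vert m) := {w | ∃ g ∈ G, act v g = w}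

/-- `O` is a `G`-orbit contained in the `n`-th level of the tree. -/
def IsLevelOrbit (G : Subgroup (TreeAut m)) (n : ℕ) (O : Set (Vert m)) : Prop :=
  ∃ v ∈ level m n, O = orbit G v

theorem finite_level (m : ℕ → ℕ) (n : ℕ) : (level m n).Finite := by
  induction n with
  | zero =>
    refine (Set.finite_singleton (root m)).subset fun v hv => ?_
    exact Subtype.ext (List.length_eq_zero_iff.1 hv)
  | succ n ih =>
    refine Set.Finite.of_finite_image (f := Subtype.val) ?_ Subtype.val_injective.injOn
    refine (((Set.finite_Iio (m n)).prod (ih.image Subtype.val)).image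
      (fun p : ℕ × List ℕ => p.1 :: p.2)).subset ?_
    rintro _ ⟨⟨w, hw⟩, hl, rfl⟩
    cases w with
    | nil => simp [level] at hl
    | cons x v =>
      have hl' : v.length = n := by simpa [level] using hl
      refine ⟨(x, v), ⟨?_, ⟨⟨v, hw.2⟩, hl', rfl⟩⟩, rfl⟩
      simpa [hl'] using hw.1

namespace IsLevelOrbit

variable {G : Subgroup (TreeAut m)} {n : ℕ} {O : Set (Vert m)}

theorem subset_level (hO : IsLevelOrbit G n O) : O ⊆ level m n := by
  obtain ⟨v, hv, rfl⟩ := hO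
  rintro _ ⟨g, -, rfl⟩
  exact act_mem_level hv g

theorem finite (hO : IsLevelOrbit G n O) : Finite O :=
  ((finite_level m n).subset hO.subset_level).to_subtype

theorem act_mem (hO : IsLevelOrbit G n O) {v : Vert m} (hv : v ∈ O) (g : G) :
    act v (g : TreeAut m) ∈ O := by
  obtain ⟨u, hu, rfl⟩ := hO
  obtain ⟨k, hk, rfl⟩ := hv
  exact ⟨k * g, G.mul_mem hk g.2, rfl⟩

theorem exists_act (hO : IsLevelOrbit G n O) {v w : Vert m} (hv : v ∈ O) (hw : w ∈ O) :
    ∃ g : G, act v (g : TreeAut m) = w := by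
  obtain ⟨u, hu, rfl⟩ := hO
  obtain ⟨k, hk, rfl⟩ := hv
  obtain ⟨l, hl, rfl⟩ := hw
  exact ⟨⟨k⁻¹ * l, G.mul_mem (G.inv_mem hk) hl⟩, by
    show act (act (act u k) k⁻¹) l = act u l
    rw [act_inv_act]⟩

end IsLevelOrbit

/-! ### Entropy -/

/-- The entropy `H(ν) = -∑ ν(e) log ν(e) ∈ [0, ∞]` of a discrete probability measure. -/
noncomputable def entropy {E : Type*} (ν : PMF E) : ℝ≥0∞ :=
  ∑' e, ENNReal.ofReal (Real.negMulLog (ν e).toReal)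

/-- The `k`-th convolution power `μ^{*k}`: the law of `g_k` for the random walk
`g_{k+1} = g_k s_{k+1}` started at `1`, whose steps `s_i` are independent with law `μ`. -/
noncomputable def convPow {Γ : Type*} [Group Γ] (μ : PMF Γ) : ℕ → PMF Γ
  | 0 => PMF.pure 1
  | k + 1 => (convPow μ k).bind fun g => μ.map fun s => g * s

/-- `h(μ) = a`, that is `H(μ^{*k}) / k → a`. -/
def HasAsymptoticEntropy {Γ : Type*} [Group Γ] (μ : PMF Γ) (a : ℝ≥0) : Prop :=
  Filter.Tendsto (fun k : ℕ => entropy (convPow μ k) / k) Filter.atTop (𝓝 (a : ℝ≥0∞))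

/-! ### Random walks with internal degrees of freedom -/

/-- A diagram on `Γ × Y`: an irreducible stochastic matrix `P = (p_{xy})` on `Y` and
probability measures `μ_{xy}` on `Γ` on the edges `p_{xy} ≠ 0`.  The data are recorded as the
probability measures `step x` on `Γ × Y` with `step x (h, y) = p_{xy} μ_{xy}(h)`; `P` and the
edge measures are recovered as `Diagram.P` and `Diagram.edgeMeasure`. -/
structure Diagram (Γ Y : Type*) where
  step : Y → PMF (Γ × Y)
  irreducible : ∀ x y,
    Relation.ReflTransGen (fun a b => (step a).map Prod.snd b ≠ 0) x y

namespace Diagram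

variable {Γ Y : Type*}

/-- The transition probabilities: `D.P x y = p_{xy}`. -/
noncomputable def P (D : Diagram Γ Y) (x : Y) : PMF Y := (D.step x).map Prod.snd

/-- The edge measures: `D.edgeMeasure x y h = μ_{xy}(h)` whenever `p_{xy} ≠ 0`. -/
noncomputable def edgeMeasure (D : Diagram Γ Y) (x y : Y) (h : Γ) : ℝ≥0∞ :=
  D.step x (h, y) / D.P x y

theorem map_snd_ne_zero_iff (ν : PMF (Γ × Y)) (y : Y) :
    ν.map Prod.snd y ≠ 0 ↔ ∃ h, ν (h, y) ≠ 0 := by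
  rw [← PMF.mem_support_iff, PMF.mem_support_map_iff]
  constructor
  · rintro ⟨⟨h, y'⟩, hp, rfl⟩
    exact ⟨h, hp⟩
  · rintro ⟨h, hp⟩
    exact ⟨(h, y), hp, rfl⟩

theorem step_eq (D : Diagram Γ Y) (x y : Y) (h : Γ) :
    D.step x (h, y) = D.P x y * D.edgeMeasure x y h := by
  by_cases h0 : D.P x y = 0
  · rw [h0, zero_mul]
    by_contra hne
    exact (map_snd_ne_zero_iff (D.step x) y).2 ⟨h, hne⟩ h0
  · exact (ENNReal.mul_div_cancel h0 (PMF.apply_ne_top _ _)).symm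

section Walk

variable [Group Γ]

/-- The law of `(g_k, y_k)` for the random walk with internal degrees of freedom with diagram
`D` and initial distribution `θ`: from `(g, x)` it moves to `(g * h, y)` with probability
`p_{xy} μ_{xy}(h)`. -/
noncomputable def law (D : Diagram Γ Y) (θ : PMF (Γ × Y)) : ℕ → PMF (Γ × Y)
  | 0 => θ
  | k + 1 => (D.law θ k).bind fun p => (D.step p.2).map fun q => (p.1 * q.1, q.2)

/-- `h(M, P) = b`: for every initial distribution of finite entropy,
`H(g_k, y_k) / k` and `H(g_k) / k` both converge to `b`. -/
def HasAsymptoticEntropy (D : Diagram Γ Y) (b : ℝ≥0) : Prop :=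
  ∀ θ : PMF (Γ × Y), entropy θ ≠ ∞ →
    Filter.Tendsto (fun k : ℕ => entropy (D.law θ k) / k) Filter.atTop (𝓝 (b : ℝ≥0∞)) ∧
    Filter.Tendsto (fun k : ℕ => entropy ((D.law θ k).map Prod.fst) / k) Filter.atTop
      (𝓝 (b : ℝ≥0∞))

open Classical in
/-- `D.firstReturn W n x (h, y)` is the probability that the walk started at `(1, x)` has its
first visit to `W` at a positive time exactly at time `n + 1`, and is then at `(h, y)`. -/
noncomputable def firstReturn (D : Diagram Γ Y) (W : Set Y) : ℕ → Y → Γ × W → ℝ≥0∞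
  | 0, x, q => D.step x (q.1, q.2.1)
  | n + 1, x, q => ∑' p : Γ × Y,
      if p.2 ∈ W then 0 else D.step x p * D.firstReturn W n p.2 (p.1⁻¹ * q.1, q.2)

open Classical in
theorem tsum_firstReturn_zero (D : Diagram Γ Y) (W : Set Y) (x : Y) :
    ∑' q, D.firstReturn W 0 x q = ∑' p : Γ × Y, if p.2 ∈ W then D.step x p else 0 := by
  have hinj : Function.Injective (fun q : Γ × W => ((q.1, q.2.1) : Γ × Y)) := by
    rintro ⟨a, b⟩ ⟨c, d⟩ h
    simp only [Prod.mk.injEq] at h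
    exact Prod.ext h.1 (Subtype.ext h.2)
  rw [← hinj.tsum_eq]
  · refine tsum_congr fun q => ?_
    simp [firstReturn]
  · rintro ⟨a, b⟩ h
    have hb : b ∈ W := by
      by_contra hb
      simp [hb] at h
    exact ⟨(a, ⟨b, hb⟩), rfl⟩

open Classical in
theorem tsum_firstReturn_succ (D : Diagram Γ Y) (W : Set Y) (n : ℕ) (x : Y) :
    ∑' q, D.firstReturn W (n + 1) x q = ∑' p : Γ × Y,
      if p.2 ∈ W then 0 else D.step x p * ∑' q, D.firstReturn W n p.2 q := by
  simp only [firstReturn]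
  rw [ENNReal.tsum_comm]
  refine tsum_congr fun p => ?_
  split_ifs with h
  · simp
  · rw [ENNReal.tsum_mul_left]
    congr 1
    exact ((Equiv.mulLeft p.1⁻¹).prodCongr (Equiv.refl W)).tsum_eq
      (fun q => D.firstReturn W n p.2 q)

/-- The probability of ever visiting `W` at a positive time. -/
noncomputable def returnProb (D : Diagram Γ Y) (W : Set Y) (x : Y) : ℝ≥0∞ :=
  ∑' n, ∑' q, D.firstReturn W n x q

open Classical in
theorem returnProb_eq (D : Diagram Γ Y) (W : Set Y) (x : Y) :
    D.returnProb W x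
      = ∑' p : Γ × Y, D.step x p * (if p.2 ∈ W then 1 else D.returnProb W p.2) := by
  rw [returnProb, tsum_eq_zero_add' ENNReal.summable, tsum_firstReturn_zero]
  simp only [tsum_firstReturn_succ]
  rw [ENNReal.tsum_comm, ← ENNReal.tsum_add]
  refine tsum_congr fun p => ?_
  split_ifs with h
  · simp
  · rw [ENNReal.tsum_mul_left, zero_add, returnProb]

open Classical in
theorem returnProb_le_one (D : Diagram Γ Y) (W : Set Y) (x : Y) : D.returnProb W x ≤ 1 := by
  rw [returnProb, ENNReal.tsum_eq_iSup_nat]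
  refine iSup_le fun N => ?_
  induction N generalizing x with
  | zero => simp
  | succ N ih =>
    rw [Finset.sum_range_succ', tsum_firstReturn_zero]
    simp only [tsum_firstReturn_succ]
    rw [← Summable.tsum_finsetSum (fun _ _ => ENNReal.summable), ← ENNReal.tsum_add,
      ← (D.step x).tsum_coe]
    refine ENNReal.tsum_le_tsum fun p => ?_
    split_ifs with h
    · simp
    · rw [add_zero, ← Finset.mul_sum]
      calc _ ≤ D.step x p * 1 := by gcongr; exact ih p.2
        _ = _ := mul_one _

/-- Recurrence of `W`. -/
theorem returnProb_eq_one [Finite Y] (D : Diagram Γ Y) {W : Set Y} (hW : W.Nonempty) (x : Y) :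
    D.returnProb W x = 1 := by
  classical
  obtain ⟨w, hw⟩ := hW
  have : Nonempty Y := ⟨w⟩
  obtain ⟨x₀, hx₀⟩ := Finite.exists_min (D.returnProb W)
  by_contra hne
  have hs : D.returnProb W x₀ < 1 :=
    lt_of_le_of_lt (hx₀ x) (lt_of_le_of_ne (D.returnProb_le_one W x) hne)
  set s := D.returnProb W x₀ with hsdef
  have key : ∀ a b, D.returnProb W a = s → (D.step a).map Prod.snd b ≠ 0 →
      b ∉ W ∧ D.returnProb W b = s := by
    intro a b ha hab
    obtain ⟨h, hh⟩ := (map_snd_ne_zero_iff _ _).1 hab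
    have hge : ∀ p : Γ × Y, s ≤ (if p.2 ∈ W then 1 else D.returnProb W p.2) := by
      intro p
      split_ifs
      · exact hs.le
      · exact hx₀ _
    have hc : (if b ∈ W then 1 else D.returnProb W b) = s := by
      by_contra hcne
      have hlt : s < (if b ∈ W then 1 else D.returnProb W b) :=
        lt_of_le_of_ne (hge (h, b)) (Ne.symm hcne)
      have hsum : ∑' p : Γ × Y, D.step a p * s = s := by
        rw [ENNReal.tsum_mul_right, PMF.tsum_coe, one_mul]
      have hlt2 : ∑' p : Γ × Y, D.step a p * s
          < ∑' p : Γ × Y, D.step a p * (if p.2 ∈ W then 1 else D.returnProb W p.2) := by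
        refine ENNReal.tsum_lt_tsum (i := (h, b)) ?_ (fun p => ?_) ?_
        · rw [hsum]; exact (hs.trans ENNReal.one_lt_top).ne
        · exact mul_le_mul_right (hge p) _
        · exact ENNReal.mul_lt_mul_right hh (PMF.apply_ne_top _ _) hlt
      rw [hsum, ← returnProb_eq, ha] at hlt2
      exact lt_irrefl _ hlt2
    by_cases hb : b ∈ W
    · rw [if_pos hb] at hc
      exact absurd hc.symm hs.ne
    · rw [if_neg hb] at hc
      exact ⟨hb, hc⟩
  obtain ⟨y, hy⟩ := ((D.step x₀).map Prod.snd).support_nonempty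
  have hy' := key x₀ y rfl hy
  have : ∀ z, Relation.ReflTransGen (fun a b => (D.step a).map Prod.snd b ≠ 0) y z →
      z ∉ W ∧ D.returnProb W z = s := by
    intro z hz
    induction hz with
    | refl => exact hy'
    | tail _ h ih => exact key _ _ ih.2 h
  exact (this w (D.irreducible y w)).1 hw

/-- The law of the first step of the trace over `W`, that is of `(g_t, y_t)` where the walk
starts at `(1, x)` and `t` is the first positive time with `y_t ∈ W`. -/
noncomputable def traceStep [Finite Y] (D : Diagram Γ Y) (W : Set Y) (hW : W.Nonempty) (x : Y) :
    PMF (Γ × W) :=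
  ⟨fun q => ∑' n, D.firstReturn W n x q, by
    have h : ∑' q, ∑' n, D.firstReturn W n x q = 1 := by
      rw [ENNReal.tsum_comm]
      exact D.returnProb_eq_one hW x
    rw [← h]
    exact ENNReal.summable.hasSum⟩

theorem traceStep_ne_zero [Finite Y] (D : Diagram Γ Y) (W : Set Y) (hW : W.Nonempty) {x : Y}
    {w : W} {n : ℕ} {h : Γ} (hne : D.firstReturn W n x (h, w) ≠ 0) :
    (D.traceStep W hW x).map Prod.snd w ≠ 0 := by
  rw [map_snd_ne_zero_iff]
  refine ⟨h, fun h0 => hne ?_⟩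
  exact ENNReal.tsum_eq_zero.1 h0 n

/-- The trace of a random walk with internal degrees of freedom over a nonempty subset `W`
of `Y`. -/
noncomputable def trace [Finite Y] (D : Diagram Γ Y) (W : Set Y) (hW : W.Nonempty) :
    Diagram Γ W where
  step x := D.traceStep W hW x
  irreducible := by
    classical
    intro x y
    set R : W → W → Prop := fun a b => (D.traceStep W hW a).map Prod.snd b ≠ 0 with hR
    have main : ∀ u : Y,
        Relation.ReflTransGen (fun a b => (D.step a).map Prod.snd b ≠ 0) u y →
        (∀ hu : u ∈ W, Relation.ReflTransGen R ⟨u, hu⟩ y) ∧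
        (u ∉ W → ∃ (w : W) (n : ℕ) (h : Γ), D.firstReturn W n u (h, w) ≠ 0 ∧
          Relation.ReflTransGen R w y) := by
      intro u hu
      induction hu using Relation.ReflTransGen.head_induction_on with
      | refl => exact ⟨fun _ => Relation.ReflTransGen.refl, fun h => absurd y.2 h⟩
      | @head u z huz _ ih =>
        obtain ⟨γ, hγ⟩ := (map_snd_ne_zero_iff _ _).1 huz
        have hE : ∃ (w : W) (n : ℕ) (h : Γ), D.firstReturn W n u (h, w) ≠ 0 ∧
            Relation.ReflTransGen R w y := by
          by_cases hz : z ∈ W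
          · exact ⟨⟨z, hz⟩, 0, γ, hγ, ih.1 hz⟩
          · obtain ⟨w, n, h, hne, hw⟩ := ih.2 hz
            refine ⟨w, n + 1, γ * h, ?_, hw⟩
            intro h0
            have h1 := ENNReal.tsum_eq_zero.1 h0 (γ, z)
            simp only [hz, if_false, inv_mul_cancel_left, mul_eq_zero] at h1
            exact h1.elim hγ hne
        refine ⟨fun hu => ?_, fun _ => hE⟩
        obtain ⟨w, n, h, hne, hw⟩ := hE
        exact Relation.ReflTransGen.head (D.traceStep_ne_zero W hW hne) hw
    exact (main x (D.irreducible x y)).1 x.2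

end Walk

end Diagram

/-! ### Ascension diagrams -/

section Ascension

variable {G : Subgroup (TreeAut m)} {n : ℕ} {O : Set (Vert m)}

/-- The one-step law of the ascension diagram: the law of `(g|_v, v · g)` when `g` has law `μ`. -/
noncomputable def ascensionStep (μ : PMF G) (hO : IsLevelOrbit G n O) (v : O) :
    PMF (sectionGroup G n × O) :=
  μ.map fun g : G =>
    (⟨sec n v.1 (hO.subset_level v.2) g,
      Subgroup.subset_closure ⟨g, g.2, v.1, hO.subset_level v.2, rfl⟩⟩,
     ⟨act v.1 (g : TreeAut m), hO.act_mem v.2 g⟩)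

theorem ascensionStep_irreducible (μ : PMF G) (hμ : Subgroup.closure μ.support = ⊤)
    (hO : IsLevelOrbit G n O) (v w : O) :
    Relation.ReflTransGen (fun a b => (ascensionStep μ hO a).map Prod.snd b ≠ 0) v w := by
  have := hO.finite
  set R : O → O → Prop := fun a b => (ascensionStep μ hO a).map Prod.snd b ≠ 0 with hR
  have main : ∀ g : G, ∀ v : O,
      Relation.ReflTransGen R v ⟨act v.1 (g : TreeAut m), hO.act_mem v.2 g⟩ := by
    intro g
    have hg : g ∈ Subgroup.closure μ.support := hμ ▸ Subgroup.mem_top g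
    induction hg using Subgroup.closure_induction with
    | mem g hg =>
      intro v
      refine Relation.ReflTransGen.single ?_
      refine (Diagram.map_snd_ne_zero_iff _ _).2
        ⟨⟨sec n v.1 (hO.subset_level v.2) g,
          Subgroup.subset_closure ⟨g, g.2, v.1, hO.subset_level v.2, rfl⟩⟩, ?_⟩
      rw [← PMF.mem_support_iff, ascensionStep, PMF.mem_support_map_iff]
      exact ⟨g, hg, rfl⟩
    | one => intro v; exact Relation.ReflTransGen.refl
    | mul g h _ _ ihg ihh => intro v; exact (ihg v).trans (ihh _)
    | inv g _ ih =>
      intro v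
      set f : O → O := fun u => ⟨act u.1 (g : TreeAut m), hO.act_mem u.2 g⟩ with hf
      have hinj : Function.Injective f := by
        intro a b hab
        exact Subtype.ext (act_injective (g : TreeAut m) (congrArg Subtype.val hab))
      set u : O := ⟨act v.1 ((g⁻¹ : G) : TreeAut m), hO.act_mem v.2 g⁻¹⟩ with hu
      have hfu : f u = v := Subtype.ext (act_act_inv v.1 (g : TreeAut m))
      obtain ⟨k, hk, hper⟩ := hinj.mem_periodicPts u
      have hiter : ∀ (j : ℕ) (a : O), Relation.ReflTransGen R a (f^[j] a) := by
        intro j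
        induction j with
        | zero => intro a; exact Relation.ReflTransGen.refl
        | succ j ihj =>
          intro a
          rw [Function.iterate_succ_apply]
          exact (ih a).trans (ihj (f a))
      obtain ⟨j, rfl⟩ : ∃ j, k = j + 1 := ⟨k - 1, by omega⟩
      have h1 : f^[j] v = u := by
        rw [← hfu, ← Function.iterate_succ_apply]
        exact hper
      rw [← h1]
      exact hiter j v
  obtain ⟨g, hg⟩ := hO.exists_act v.2 w.2
  have := main g v
  rwa [show (⟨act v.1 (g : TreeAut m), hO.act_mem v.2 g⟩ : O) = w from Subtype.ext hg] at this

/-- The ascension diagram `T_O(μ)` on `G^{(n)} × O` for a `G`-orbit `O` in level `n`: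
`p_{vw} = μ{g : v · g = w}` and `p_{vw} μ_{vw}(h) = μ{g : v · g = w, g|_v = h}`. -/
noncomputable def orbitAscension (μ : PMF G) (hμ : Subgroup.closure μ.support = ⊤)
    (hO : IsLevelOrbit G n O) : Diagram (sectionGroup G n) O where
  step := ascensionStep μ hO
  irreducible := ascensionStep_irreducible μ hμ hO

/-- The ascension diagram `T_W(μ)`: the trace of `T_O(μ)` over a nonempty subset `W` of `O`. -/
noncomputable def ascension (μ : PMF G) (hμ : Subgroup.closure μ.support = ⊤)
    (hO : IsLevelOrbit G n O) (W : Set O) (hW : W.Nonempty) : Diagram (sectionGroup G n) W :=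
  haveI := hO.finite
  (orbitAscension μ hμ hO).trace W hW

end Ascension

end RootedTree

/-!
An automorphism `g` is determined by its action on the first `n` levels, for which there are
finitely many possibilities, together with its sections at the vertices of level `n` (`ext_of_sec`).
If `g_k` is the random walk on `G` with step law `μ`, then `(g_k|_v, v · g_k)` is the random walk
with internal degrees of freedom of the ascension diagram of the orbit of `v`
(`map_sectionPair_convPow`).  Subadditivity of entropy therefore bounds `H(g_k)` by a constant plus
the sum of the entropies of these walks over all vertices `v` of level `n`
(`exists_entropy_convPow_le`).  Dividing by `k` gives `h(μ) ≤ ∑ |O_i| h(T_{O_i}(μ))`, and it remains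
to see that `|Y| h(D) ≤ |W| h(D_W)` if `D_W` is the trace over `W` of a diagram `D` over a finite
set `Y` with a doubly stochastic transition matrix (`Diagram.card_mul_le_ncard_mul`).  Transition
matrices over orbits are doubly stochastic because each `g` permutes the orbit
(`sum_transition_orbitAscension`).

*Existence of the asymptotic entropies.*  Let `H_x(k)` be the entropy at time `k` of the walk
started at `(1, x)`.  Up to a bounded error it is at most the mean of `H_y(k)` after one step from
`x`, so by a quantitative maximum principle (`exists_osc_le`) its oscillation in `x` is bounded
uniformly in `k`.  Hence `H_x` is subadditive up to a constant, Fekete's lemma applies, and the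
limit depends neither on `x` nor on the initial distribution
(`Diagram.exists_hasAsymptoticEntropy`).  For traces this needs the finiteness of the entropy of
one step, which holds since the expected return time is finite and entropy is lower semicontinuous
(`Diagram.entropy_traceStep_le`).

*Comparison with the trace.*  Let `σ` be the time of the `r`-th visit to `W`, and consider the walk at
time `max K σ`.  It arises from the walk at time `σ` by `max (K - σ) 0` further steps, which bounds
its entropy from above.  It also arises from the walk at time `K` by an increment which, given the
internal state and the number of missing visits, is independent of the past, so that its entropy
is at least the one at time `K` up to a logarithmic error
(`Diagram.entropy_walk_le_entropy_visit_add`).  For `K = i |Y|` and `r = i |W|` the expected value of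
`max (K - σ) 0` is `O(√i)` by a second moment estimate, for which a solution of the Poisson equation
turns the number of visits into a martingale with bounded increments
(`Diagram.exists_tsum_stoppedWalk_mul_le`).
-/

namespace RootedTree

/-! ### Entropy of discrete measures -/

section Entropy

variable {A B E : Type*}

/-- The information content `-log q` of an event of probability `q ≤ 1`, with the junk value `0`
at `q = 0`. -/
noncomputable def info (q : ℝ≥0∞) : ℝ≥0∞ := ENNReal.ofReal (-Real.log q.toReal)

theorem entropy_eq_tsum_mul_info (ν : PMF E) : entropy ν = ∑' e, ν e * info (ν e) := by
  refine tsum_congr fun e => ?_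
  rw [Real.negMulLog, neg_mul, ← mul_neg, ENNReal.ofReal_mul ENNReal.toReal_nonneg,
    ENNReal.ofReal_toReal (PMF.apply_ne_top _ _), info]

theorem info_anti {p q : ℝ≥0∞} (hp : p ≠ 0) (hpq : p ≤ q) (hq : q ≠ ∞) : info q ≤ info p := by
  have h1 : 0 < p.toReal := ENNReal.toReal_pos hp (ne_top_of_le_ne_top hq hpq)
  have h2 : p.toReal ≤ q.toReal := ENNReal.toReal_mono hq hpq
  exact ENNReal.ofReal_le_ofReal (neg_le_neg (Real.log_le_log h1 h2))

theorem toReal_le_one {p : ℝ≥0∞} (hp : p ≤ 1) : p.toReal ≤ 1 := by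
  simpa using ENNReal.toReal_mono ENNReal.one_ne_top hp

theorem info_mul {p q : ℝ≥0∞} (hp : p ≠ 0) (hq : q ≠ 0) (hp1 : p ≤ 1) (hq1 : q ≤ 1) :
    info (p * q) = info p + info q := by
  have h1 : 0 < p.toReal := ENNReal.toReal_pos hp (ne_top_of_le_ne_top ENNReal.one_ne_top hp1)
  have h2 : 0 < q.toReal := ENNReal.toReal_pos hq (ne_top_of_le_ne_top ENNReal.one_ne_top hq1)
  have h3 := Real.log_nonpos h1.le (toReal_le_one hp1)
  have h4 := Real.log_nonpos h2.le (toReal_le_one hq1)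
  rw [info, info, info, ENNReal.toReal_mul, Real.log_mul h1.ne' h2.ne', neg_add,
    ENNReal.ofReal_add (by linarith) (by linarith)]

theorem tsum_bind_mul (p : PMF A) (f : A → PMF B) (F : B → ℝ≥0∞) :
    ∑' b, p.bind f b * F b = ∑' a, p a * ∑' b, f a b * F b := by
  simp only [PMF.bind_apply, ← ENNReal.tsum_mul_right, ← ENNReal.tsum_mul_left]
  rw [ENNReal.tsum_comm]
  simp only [mul_assoc]

theorem tsum_pure_mul (a : A) (F : A → ℝ≥0∞) : ∑' b, PMF.pure a b * F b = F a := by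
  classical
  rw [tsum_eq_single a]
  · simp
  · intro b hb
    simp [PMF.pure_apply, hb]

theorem tsum_map_mul (p : PMF A) (f : A → B) (F : B → ℝ≥0∞) :
    ∑' b, p.map f b * F b = ∑' a, p a * F (f a) := by
  rw [PMF.map, tsum_bind_mul]
  simp only [Function.comp_apply, tsum_pure_mul]

theorem apply_le_map_apply (p : PMF A) (f : A → B) (a : A) : p a ≤ p.map f (f a) := by
  classical
  rw [PMF.map_apply]
  refine le_trans ?_ (ENNReal.le_tsum a)
  simp

theorem map_apply_of_injective (p : PMF A) {f : A → B} (hf : Function.Injective f) (a : A) :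
    p.map f (f a) = p a := by
  classical
  rw [PMF.map_apply, tsum_eq_single a]
  · simp
  · intro b hb
    rw [if_neg fun h => hb (hf h).symm]

theorem map_apply_of_notMem_range (p : PMF A) {f : A → B} {b : B} (hb : b ∉ Set.range f) :
    p.map f b = 0 := by
  classical
  rw [PMF.map_apply, ENNReal.tsum_eq_zero]
  intro a
  rw [if_neg fun h => hb ⟨a, h.symm⟩]

theorem tsum_mul_le_of_le (p : PMF A) {F : A → ℝ≥0∞} {c : ℝ≥0∞} (h : ∀ a, p a ≠ 0 → F a ≤ c) :
    ∑' a, p a * F a ≤ c := by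
  calc ∑' a, p a * F a ≤ ∑' a, p a * c := by
        refine ENNReal.tsum_le_tsum fun a => ?_
        by_cases ha : p a = 0
        · simp [ha]
        · exact mul_le_mul_right (h a ha) _
    _ = c := by rw [ENNReal.tsum_mul_right, p.tsum_coe, one_mul]

theorem entropy_pure (a : A) : entropy (PMF.pure a) = 0 := by
  rw [entropy_eq_tsum_mul_info, tsum_pure_mul]
  simp [info]

/-- Applying a function does not increase the entropy. -/
theorem entropy_map_le (p : PMF A) (f : A → B) : entropy (p.map f) ≤ entropy p := by
  rw [entropy_eq_tsum_mul_info, entropy_eq_tsum_mul_info, tsum_map_mul]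
  refine ENNReal.tsum_le_tsum fun a => ?_
  by_cases ha : p a = 0
  · simp [ha]
  · exact mul_le_mul_right (info_anti ha (apply_le_map_apply p f a) (PMF.apply_ne_top _ _)) _

theorem entropy_map_of_injective (p : PMF A) {f : A → B} (hf : Function.Injective f) :
    entropy (p.map f) = entropy p := by
  rw [entropy_eq_tsum_mul_info, entropy_eq_tsum_mul_info, tsum_map_mul]
  simp only [map_apply_of_injective p hf]

/-- Gibbs' inequality: among all subprobability weights `q`, the expectation of `-log q` under
`p` is least for `q = p`. -/
theorem entropy_le_tsum_mul_info (p : PMF A) (q : A → ℝ≥0∞) (hq : ∑' a, q a ≤ 1)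
    (h0 : ∀ a, p a ≠ 0 → q a ≠ 0) : entropy p ≤ ∑' a, p a * info (q a) := by
  rw [entropy_eq_tsum_mul_info]
  have key : ∀ a, p a * info (p a) + p a ≤ p a * info (q a) + q a := by
    intro a
    by_cases ha : p a = 0
    · simp [ha]
    have hq1 : q a ≤ 1 := (ENNReal.le_tsum a).trans hq
    have hqt : q a ≠ ∞ := ne_top_of_le_ne_top ENNReal.one_ne_top hq1
    have hpt : p a ≠ ∞ := PMF.apply_ne_top _ _
    have hx : 0 < (p a).toReal := ENNReal.toReal_pos ha hpt
    have hy : 0 < (q a).toReal := ENNReal.toReal_pos (h0 a ha) hqt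
    have lx := Real.log_nonpos hx.le (toReal_le_one (PMF.coe_le_one p a))
    have ly := Real.log_nonpos hy.le (toReal_le_one hq1)
    conv_lhs => rw [← ENNReal.ofReal_toReal hpt]
    conv_rhs => rw [← ENNReal.ofReal_toReal hpt, ← ENNReal.ofReal_toReal hqt]
    rw [info, info, ENNReal.toReal_ofReal hx.le, ENNReal.toReal_ofReal hy.le,
      ← ENNReal.ofReal_mul hx.le, ← ENNReal.ofReal_mul hx.le,
      ← ENNReal.ofReal_add (mul_nonneg hx.le (by linarith)) hx.le,
      ← ENNReal.ofReal_add (mul_nonneg hx.le (by linarith)) hy.le]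
    refine ENNReal.ofReal_le_ofReal ?_
    have h := Real.log_le_sub_one_of_pos (div_pos hy hx)
    rw [Real.log_div hy.ne' hx.ne'] at h
    have h2 := mul_le_mul_of_nonneg_left h hx.le
    have h3 : (p a).toReal * ((q a).toReal / (p a).toReal - 1) = (q a).toReal - (p a).toReal := by
      field_simp
    rw [h3] at h2
    linarith
  have hsum := ENNReal.tsum_le_tsum key
  rw [ENNReal.tsum_add, ENNReal.tsum_add, p.tsum_coe] at hsum
  exact (ENNReal.add_le_add_iff_right ENNReal.one_ne_top).1 (hsum.trans (add_le_add le_rfl hq))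

/-- Subadditivity of entropy. -/
theorem entropy_le_entropy_fst_add_entropy_snd (p : PMF (A × B)) :
    entropy p ≤ entropy (p.map Prod.fst) + entropy (p.map Prod.snd) := by
  have hne1 : ∀ e, p e ≠ 0 → p.map Prod.fst e.1 ≠ 0 := fun e he h =>
    he (le_zero_iff.1 (h ▸ apply_le_map_apply p Prod.fst e))
  have hne2 : ∀ e, p e ≠ 0 → p.map Prod.snd e.2 ≠ 0 := fun e he h =>
    he (le_zero_iff.1 (h ▸ apply_le_map_apply p Prod.snd e))
  refine (entropy_le_tsum_mul_info p (fun e => p.map Prod.fst e.1 * p.map Prod.snd e.2) ?_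
    fun e he => mul_ne_zero (hne1 e he) (hne2 e he)).trans (le_of_eq ?_)
  · rw [ENNReal.tsum_prod']
    simp only [ENNReal.tsum_mul_left, PMF.tsum_coe, mul_one, le_refl]
  · rw [entropy_eq_tsum_mul_info (p.map Prod.fst), entropy_eq_tsum_mul_info (p.map Prod.snd),
      tsum_map_mul, tsum_map_mul, ← ENNReal.tsum_add]
    refine tsum_congr fun e => ?_
    by_cases he : p e = 0
    · simp [he]
    · rw [info_mul (hne1 e he) (hne2 e he) (PMF.coe_le_one _ _) (PMF.coe_le_one _ _), mul_add]

/-- A measure carried by a finite set has entropy at most the logarithm of its cardinality. -/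
theorem entropy_le_log_card (p : PMF A) (s : Finset A) (hs : ∀ a, p a ≠ 0 → a ∈ s) :
    entropy p ≤ ENNReal.ofReal (Real.log s.card) := by
  classical
  have hne : s.Nonempty := by
    obtain ⟨a, ha⟩ := p.support_nonempty
    exact ⟨a, hs a ha⟩
  have hc : (s.card : ℝ≥0∞) ≠ 0 := by
    simpa using hne.ne_empty
  refine (entropy_le_tsum_mul_info p (fun a => if a ∈ s then (s.card : ℝ≥0∞)⁻¹ else 0) ?_
    fun a ha => by simp [hs a ha]).trans ?_
  · rw [tsum_eq_sum (s := s) fun a ha => if_neg ha, Finset.sum_congr rfl fun a ha => if_pos ha,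
      Finset.sum_const, nsmul_eq_mul, ENNReal.mul_inv_cancel hc (ENNReal.natCast_ne_top _)]
  · refine tsum_mul_le_of_le p fun a ha => ?_
    simp [hs a ha, info, Real.log_inv]

theorem entropy_le_log_natCard [Finite A] (p : PMF A) :
    entropy p ≤ ENNReal.ofReal (Real.log (Nat.card A)) := by
  have := Fintype.ofFinite A
  rw [Nat.card_eq_fintype_card]
  exact entropy_le_log_card p Finset.univ fun a _ => Finset.mem_univ a

/-- The chain rule for entropy. -/
theorem entropy_bind_map_mk (p : PMF A) (f : A → PMF B) :
    entropy (p.bind fun a => (f a).map (Prod.mk a)) = entropy p + ∑' a, p a * entropy (f a) := by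
  set J := p.bind fun a => (f a).map (Prod.mk a) with hJ
  have hJa : ∀ a b, J (a, b) = p a * f a b := by
    intro a b
    rw [hJ, PMF.bind_apply, tsum_eq_single a]
    · rw [map_apply_of_injective _ (Prod.mk_right_injective a)]
    · intro a' ha'
      rw [map_apply_of_notMem_range, mul_zero]
      rintro ⟨b', h⟩
      exact ha' (congrArg Prod.fst h)
  rw [entropy_eq_tsum_mul_info, entropy_eq_tsum_mul_info,
    ENNReal.tsum_prod',
    ← ENNReal.tsum_add]
  refine tsum_congr fun a => ?_
  simp only [hJa]
  by_cases ha : p a = 0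
  · simp [ha]
  rw [entropy_eq_tsum_mul_info]
  calc ∑' b, p a * f a b * info (p a * f a b)
      = ∑' b, (f a b * (p a * info (p a)) + p a * (f a b * info (f a b))) := by
        refine tsum_congr fun b => ?_
        by_cases hb : f a b = 0
        · simp [hb]
        · rw [info_mul ha hb (PMF.coe_le_one _ _) (PMF.coe_le_one _ _)]
          ring
    _ = _ := by
        rw [ENNReal.tsum_add, ENNReal.tsum_mul_right, ENNReal.tsum_mul_left, PMF.tsum_coe, one_mul]

theorem entropy_bind_le (p : PMF A) (f : A → PMF B) :
    entropy (p.bind f) ≤ entropy p + ∑' a, p a * entropy (f a) := by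
  rw [← entropy_bind_map_mk]
  have h : p.bind f = (p.bind fun a => (f a).map (Prod.mk a)).map Prod.snd := by
    rw [PMF.map_bind]
    congr 1
    funext a
    rw [PMF.map_comp]
    exact (PMF.map_id _).symm
  rw [h]
  exact entropy_map_le _ _

/-- Concavity of entropy. -/
theorem tsum_mul_entropy_le_entropy_bind (p : PMF A) (f : A → PMF B) (hp : entropy p ≠ ∞) :
    ∑' a, p a * entropy (f a) ≤ entropy (p.bind f) := by
  have h := entropy_le_entropy_fst_add_entropy_snd (p.bind fun a => (f a).map (Prod.mk a))
  rw [entropy_bind_map_mk] at h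
  have h1 : (p.bind fun a => (f a).map (Prod.mk a)).map Prod.fst = p := by
    rw [PMF.map_bind]
    conv_rhs => rw [← PMF.bind_pure p]
    congr 1
    funext a
    rw [PMF.map_comp]
    exact PMF.map_const _ _
  have h2 : (p.bind fun a => (f a).map (Prod.mk a)).map Prod.snd = p.bind f := by
    rw [PMF.map_bind]
    congr 1
    funext a
    rw [PMF.map_comp]
    exact PMF.map_id _
  rw [h1, h2] at h
  exact (ENNReal.add_le_add_iff_left hp).1 h

/-- The joint entropy of finitely many random variables is at most the sum of their
entropies. -/
theorem entropy_map_list_map_le {ι : Type*} (p : PMF E) (f : ι → E → A) (l : List ι) :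
    entropy (p.map fun e => l.map fun i => f i e)
      ≤ (l.map fun i => entropy (p.map (f i))).sum := by
  induction l with
  | nil =>
    have : (p.map fun e => ([] : List ι).map fun i => f i e) = PMF.pure [] := PMF.map_const _ _
    rw [this, entropy_pure]
    simp
  | cons i l ih =>
    have h : (p.map fun e => (i :: l).map fun i => f i e)
        = (p.map fun e => (f i e, l.map fun i => f i e)).map fun q => q.1 :: q.2 := by
      rw [PMF.map_comp]
      rfl
    rw [h, List.map_cons, List.sum_cons]
    refine (entropy_map_le _ _).trans ((entropy_le_entropy_fst_add_entropy_snd _).trans ?_)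
    rw [PMF.map_comp, PMF.map_comp]
    exact add_le_add le_rfl ih

end Entropy

/-! ### Composition of random walk kernels -/

section Conv

variable {Γ X Y Z : Type*} [Group Γ]

/-- The law of `(g * h, y)` when `(g, z)` has law `p` and `(h, y)` has law `κ z`: the point
`(g, z)` is moved by an increment whose law depends on the internal state `z` only. -/
noncomputable def conv (p : PMF (Γ × Z)) (κ : Z → PMF (Γ × Y)) : PMF (Γ × Y) :=
  p.bind fun q => (κ q.2).map fun r => (q.1 * r.1, r.2)

theorem conv_conv (p : PMF (Γ × X)) (κ : X → PMF (Γ × Y)) (l : Y → PMF (Γ × Z)) :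
    conv (conv p κ) l = conv p fun z => conv (κ z) l := by
  simp only [conv, PMF.bind_bind, PMF.map_bind, PMF.bind_map, PMF.map_comp, Function.comp_def,
    mul_assoc]

theorem pure_conv (z : Z) (κ : Z → PMF (Γ × Y)) : conv (PMF.pure (1, z)) κ = κ z := by
  simp only [conv, PMF.pure_bind, one_mul]
  exact PMF.map_id _

theorem conv_pure (p : PMF (Γ × Z)) : (conv p fun z => PMF.pure (1, z)) = p := by
  simp only [conv, PMF.pure_map, mul_one]
  exact PMF.bind_pure p

theorem map_conv (p : PMF (Γ × X)) (κ : X → PMF (Γ × Y)) (f : Y → Z) :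
    (conv p κ).map (Prod.map id f) = conv p fun x => (κ x).map (Prod.map id f) := by
  simp only [conv, PMF.map_bind, PMF.map_comp]
  rfl

theorem conv_map (p : PMF (Γ × X)) (f : X → Y) (κ : Y → PMF (Γ × Z)) :
    conv (p.map (Prod.map id f)) κ = conv p fun x => κ (f x) := by
  simp only [conv, PMF.bind_map]
  rfl

theorem tsum_conv_mul (p : PMF (Γ × X)) (κ : X → PMF (Γ × Y)) (F : Y → ℝ≥0∞) :
    ∑' r, conv p κ r * F r.2 = ∑' q, p q * ∑' r, κ q.2 r * F r.2 := by
  simp only [conv, tsum_bind_mul, tsum_map_mul]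

theorem injective_translate (g : Γ) :
    Function.Injective fun r : Γ × Y => (g * r.1, r.2) := by
  rintro ⟨a, b⟩ ⟨a', b'⟩ h
  simpa using h

theorem entropy_conv_le (p : PMF (Γ × X)) (κ : X → PMF (Γ × Y)) :
    entropy (conv p κ) ≤ entropy p + ∑' q, p q * entropy (κ q.2) := by
  refine (entropy_bind_le _ _).trans (le_of_eq ?_)
  simp only [entropy_map_of_injective _ (injective_translate _)]

theorem tsum_mul_entropy_le_entropy_conv (p : PMF (Γ × X)) (κ : X → PMF (Γ × Y))
    (hp : entropy p ≠ ∞) : ∑' q, p q * entropy (κ q.2) ≤ entropy (conv p κ) := by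
  refine le_trans (le_of_eq ?_) (tsum_mul_entropy_le_entropy_bind p _ hp)
  simp only [entropy_map_of_injective _ (injective_translate _)]

/-- Composition with a kernel can only lose the information contained in the internal state: given
that state, the increment is independent of the position and can be undone. -/
theorem entropy_le_entropy_conv_add (p : PMF (Γ × X)) (κ : X → PMF (Γ × Y))
    (hκ : ∑' q, p q * entropy (κ q.2) ≠ ∞) :
    entropy p ≤ entropy (conv p κ) + entropy (p.map Prod.snd) := by
  set S := ∑' q, p q * entropy (κ q.2) with hS
  set M := p.bind fun q => (κ q.2).map (Prod.mk q) with hM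
  have hinj : Function.Injective fun e : (Γ × X) × (Γ × Y) =>
      ((e.1.1 * e.2.1, e.2.2), (e.1.2, e.2)) := by
    rintro ⟨⟨a, b⟩, c, d⟩ ⟨⟨a', b'⟩, c', d'⟩ h
    simp only [Prod.mk.injEq] at h
    obtain ⟨⟨h1, -⟩, h2, h3, h4⟩ := h
    subst h2 h3 h4
    simpa using h1
  have h1 : entropy M = entropy p + S := entropy_bind_map_mk p fun q => κ q.2
  have h2 := entropy_le_entropy_fst_add_entropy_snd (M.map fun e : (Γ × X) × (Γ × Y) =>
      ((e.1.1 * e.2.1, e.2.2), (e.1.2, e.2)))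
  rw [entropy_map_of_injective M hinj, h1, PMF.map_comp, PMF.map_comp] at h2
  have h3 : M.map (Prod.fst ∘ fun e : (Γ × X) × (Γ × Y) =>
      ((e.1.1 * e.2.1, e.2.2), (e.1.2, e.2))) = conv p κ := by
    rw [hM, PMF.map_bind, conv]
    simp only [PMF.map_comp]
    rfl
  have h4 : M.map (Prod.snd ∘ fun e : (Γ × X) × (Γ × Y) =>
      ((e.1.1 * e.2.1, e.2.2), (e.1.2, e.2)))
      = (p.map Prod.snd).bind fun z => (κ z).map (Prod.mk z) := by
    rw [hM, PMF.map_bind, PMF.bind_map]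
    simp only [PMF.map_comp]
    rfl
  rw [h3, h4, entropy_bind_map_mk, tsum_map_mul p Prod.snd fun z => entropy (κ z), ← hS,
    ← add_assoc] at h2
  exact (ENNReal.add_le_add_iff_right hκ).1 h2

end Conv

/-! ### Irreducible stochastic matrices -/

/-- Quantitative maximum principle: a function that is subharmonic up to an error `c` has
oscillation at most a multiple of `c`. -/
theorem exists_osc_le {Y : Type*} [Fintype Y] (p : Y → Y → ℝ) (h0 : ∀ x y, 0 ≤ p x y)
    (h1 : ∀ x, ∑ y, p x y = 1)
    (hirr : ∀ x y, Relation.ReflTransGen (fun a b => p a b ≠ 0) x y) :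
    ∃ K : ℝ, 0 ≤ K ∧ ∀ (f : Y → ℝ) (c : ℝ), 0 ≤ c → (∀ x, f x ≤ ∑ y, p x y * f y + c) →
      ∀ x y, f x ≤ f y + K * c := by
  classical
  -- Along an edge, the defect `M - f` grows at most by a bounded factor and a multiple of `c`.
  have key : ∀ x y, ∃ K : ℝ, 0 ≤ K ∧ ∀ (f : Y → ℝ) (c M : ℝ), 0 ≤ c →
      (∀ x, f x ≤ ∑ y, p x y * f y + c) → (∀ z, f z ≤ M) → f x = M → M - f y ≤ K * c := by
    intro x y
    induction hirr x y with
    | refl => exact ⟨0, le_rfl, fun f c M _ _ _ h => by rw [h]; simp⟩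
    | @tail z y _ hzy ih =>
      obtain ⟨K, hK, ih⟩ := ih
      have hpos : 0 < p z y := lt_of_le_of_ne (h0 z y) (Ne.symm hzy)
      refine ⟨(K + 1) / p z y, by positivity, fun f c M hc hf hM hx => ?_⟩
      have h2 := ih f c M hc hf hM hx
      have h3 : p z y * (M - f y) ≤ ∑ w, p z w * (M - f w) :=
        Finset.single_le_sum (f := fun w => p z w * (M - f w))
          (fun w _ => mul_nonneg (h0 z w) (sub_nonneg.2 (hM w))) (Finset.mem_univ y)
      have h4 : ∑ w, p z w * (M - f w) = M - ∑ w, p z w * f w := by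
        simp only [mul_sub, Finset.sum_sub_distrib, ← Finset.sum_mul, h1, one_mul]
      have h5 := hf z
      rw [div_mul_eq_mul_div, le_div_iff₀ hpos]
      nlinarith
  choose K hK hKf using key
  refine ⟨∑ x, ∑ y, K x y, Finset.sum_nonneg fun x _ => Finset.sum_nonneg fun y _ => hK x y, ?_⟩
  intro f c hc hf x y
  have : Nonempty Y := ⟨x⟩
  obtain ⟨x₀, hx₀⟩ := Finite.exists_max f
  have h2 := hKf x₀ y f c (f x₀) hc hf hx₀ rfl
  have h3 : K x₀ y ≤ ∑ x, ∑ y, K x y :=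
    (Finset.single_le_sum (f := K x₀) (fun y _ => hK x₀ y) (Finset.mem_univ y)).trans
      (Finset.single_le_sum (f := fun x => ∑ y, K x y)
        (fun x _ => Finset.sum_nonneg fun y _ => hK x y) (Finset.mem_univ x₀))
  have h4 := mul_le_mul_of_nonneg_right h3 hc
  have h5 := hx₀ x
  linarith

/-! ### Existence of the asymptotic entropy -/

theorem tendsto_const_div_natCast {c : ℝ≥0∞} (hc : c ≠ ∞) :
    Filter.Tendsto (fun k : ℕ => c / k) Filter.atTop (𝓝 0) := by
  have := ENNReal.Tendsto.const_div (b := ∞) ENNReal.tendsto_nat_nhds_top (Or.inr hc)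
  rwa [ENNReal.div_top] at this

theorem tendsto_div_natCast_of_le_add {u v : ℕ → ℝ≥0∞} {b : ℝ≥0} {c : ℝ≥0∞} (hc : c ≠ ∞)
    (huv : ∀ k, u k ≤ v k + c) (hvu : ∀ k, v k ≤ u k + c)
    (hu : Filter.Tendsto (fun k : ℕ => u k / k) Filter.atTop (𝓝 (b : ℝ≥0∞))) :
    Filter.Tendsto (fun k : ℕ => v k / k) Filter.atTop (𝓝 (b : ℝ≥0∞)) := by
  have h0 := tendsto_const_div_natCast hc
  have h1 : Filter.Tendsto (fun k : ℕ => u k / k - c / k) Filter.atTop (𝓝 (b : ℝ≥0∞)) := by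
    simpa using ENNReal.Tendsto.sub hu h0 (Or.inl ENNReal.coe_ne_top)
  have h2 : Filter.Tendsto (fun k : ℕ => u k / k + c / k) Filter.atTop (𝓝 (b : ℝ≥0∞)) := by
    simpa using hu.add h0
  refine tendsto_of_tendsto_of_tendsto_of_le_of_le h1 h2 (fun k => ?_) fun k => ?_
  · rw [tsub_le_iff_right, ← ENNReal.add_div]
    exact ENNReal.div_le_div_right (huv k) _
  · rw [← ENNReal.add_div]
    exact ENNReal.div_le_div_right (hvu k) _

namespace Diagram

variable {Γ Y : Type*} (D : Diagram Γ Y)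

/-- The transition matrix with real entries. -/
noncomputable def transition (x y : Y) : ℝ := (D.P x y).toReal

theorem transition_nonneg (x y : Y) : 0 ≤ D.transition x y := ENNReal.toReal_nonneg

theorem tsum_step_mul [Fintype Y] (x : Y) (F : Y → ℝ≥0∞) :
    ∑' q, D.step x q * F q.2 = ∑ y, D.P x y * F y := by
  rw [← tsum_fintype (L := .unconditional Y), P, tsum_map_mul]

theorem sum_transition [Fintype Y] (x : Y) : ∑ y, D.transition x y = 1 := by
  have h : ∑ y, D.P x y = 1 := by
    rw [← tsum_fintype (L := .unconditional Y)]
    exact PMF.tsum_coe _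
  simp only [transition]
  rw [← ENNReal.toReal_sum fun y _ => PMF.apply_ne_top _ _, h, ENNReal.toReal_one]

theorem transition_irreducible (x y : Y) :
    Relation.ReflTransGen (fun a b => D.transition a b ≠ 0) x y :=
  Relation.ReflTransGen.mono (fun _ _ h => (ENNReal.toReal_pos h (PMF.apply_ne_top _ _)).ne')
    _ _ (D.irreducible x y)

theorem tsum_step_mul_ofReal [Fintype Y] (x : Y) (f : Y → ℝ) (hf : ∀ y, 0 ≤ f y) :
    ∑' q, D.step x q * ENNReal.ofReal (f q.2)
      = ENNReal.ofReal (∑ y, D.transition x y * f y) := by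
  rw [D.tsum_step_mul x fun y => ENNReal.ofReal (f y), ENNReal.ofReal_sum_of_nonneg
    fun y _ => mul_nonneg (D.transition_nonneg x y) (hf y)]
  refine Finset.sum_congr rfl fun y _ => ?_
  rw [ENNReal.ofReal_mul (D.transition_nonneg x y), transition,
    ENNReal.ofReal_toReal (PMF.apply_ne_top _ _)]

theorem exists_entropy_step_le [Finite Y] {D : Diagram Γ Y} (hD : ∀ x, entropy (D.step x) ≠ ∞) :
    ∃ C : ℝ≥0, ∀ x, entropy (D.step x) ≤ C := by
  have := Fintype.ofFinite Y
  refine ⟨∑ x, (entropy (D.step x)).toNNReal, fun x => ?_⟩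
  rw [← ENNReal.coe_toNNReal (hD x), ENNReal.coe_le_coe]
  exact Finset.single_le_sum (f := fun x => (entropy (D.step x)).toNNReal)
    (fun _ _ => zero_le) (Finset.mem_univ x)

variable [Group Γ]

/-- The law at time `k` of the random walk with internal degrees of freedom started at
`(1, x)`. -/
noncomputable def walk (x : Y) (k : ℕ) : PMF (Γ × Y) := D.law (PMF.pure (1, x)) k

theorem law_succ (θ : PMF (Γ × Y)) (k : ℕ) : D.law θ (k + 1) = conv (D.law θ k) D.step := rfl

theorem walk_zero (x : Y) : D.walk x 0 = PMF.pure (1, x) := rfl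

/-- The walk with initial law `θ` is a mixture of translates of the walks started at `1`. -/
theorem law_eq_conv_walk (θ : PMF (Γ × Y)) (k : ℕ) :
    D.law θ k = conv θ fun x => D.walk x k := by
  induction k with
  | zero => exact (conv_pure θ).symm
  | succ k ih => rw [law_succ, ih, conv_conv]; rfl

/-- The Markov property. -/
theorem law_add (θ : PMF (Γ × Y)) (j k : ℕ) : D.law θ (j + k) = D.law (D.law θ j) k := by
  induction k with
  | zero => rfl
  | succ k ih => rw [← add_assoc, law_succ, ih, law_succ]

theorem walk_add (x : Y) (j k : ℕ) :
    D.walk x (j + k) = conv (D.walk x j) fun y => D.walk y k := by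
  rw [walk, law_add, law_eq_conv_walk, walk]

theorem walk_one (x : Y) : D.walk x 1 = D.step x := pure_conv x D.step

theorem walk_succ (x : Y) (k : ℕ) :
    D.walk x (k + 1) = conv (D.step x) fun y => D.walk y k := by
  rw [add_comm, walk_add, walk_one]

theorem entropy_walk_le {D : Diagram Γ Y} {C : ℝ≥0} (hC : ∀ x, entropy (D.step x) ≤ C)
    (x : Y) (k : ℕ) :
    entropy (D.walk x k) ≤ C * k := by
  induction k with
  | zero => rw [walk_zero, entropy_pure]; exact zero_le
  | succ k ih =>
    rw [walk_add]
    refine (entropy_conv_le _ _).trans ?_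
    rw [Nat.cast_succ, mul_add, mul_one]
    refine add_le_add ih (tsum_mul_le_of_le _ fun q _ => ?_)
    rw [walk_one]
    exact hC q.2

section Finite

variable [Finite Y] {D}

theorem entropy_walk_ne_top (hD : ∀ x, entropy (D.step x) ≠ ∞) (x : Y) (k : ℕ) :
    entropy (D.walk x k) ≠ ∞ := by
  obtain ⟨C, hC⟩ := exists_entropy_step_le hD
  exact ne_top_of_le_ne_top (ENNReal.mul_ne_top ENNReal.coe_ne_top (ENNReal.natCast_ne_top k))
    (entropy_walk_le hC x k)

/-- The entropy of the walk is nondecreasing in time up to the entropy of the internal state. -/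
theorem entropy_walk_le_entropy_walk_succ_add (hD : ∀ x, entropy (D.step x) ≠ ∞) (x : Y) (k : ℕ) :
    entropy (D.walk x k)
      ≤ entropy (D.walk x (k + 1)) + ENNReal.ofReal (Real.log (Nat.card Y)) := by
  obtain ⟨C, hC⟩ := exists_entropy_step_le hD
  have h := entropy_le_entropy_conv_add (D.walk x k) D.step
    (ne_top_of_le_ne_top ENNReal.coe_ne_top (tsum_mul_le_of_le _ fun q _ => hC q.2))
  exact h.trans (add_le_add le_rfl (entropy_le_log_natCard _))

/-- The entropies of the walks with different initial states stay within bounded distance. -/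
theorem exists_entropy_walk_le_add (hD : ∀ x, entropy (D.step x) ≠ ∞) :
    ∃ K : ℝ≥0, ∀ (k : ℕ) (x y : Y), entropy (D.walk x k) ≤ entropy (D.walk y k) + K := by
  have := Fintype.ofFinite Y
  obtain ⟨C, hC⟩ := exists_entropy_step_le hD
  obtain ⟨K, hK, hosc⟩ := exists_osc_le D.transition D.transition_nonneg D.sum_transition
    D.transition_irreducible
  set L : ℝ≥0 := (Real.log (Nat.card Y)).toNNReal with hL
  refine ⟨(K * (C + L)).toNNReal, fun k x y => ?_⟩
  have hfin := entropy_walk_ne_top hD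
  -- Splitting off the first step shows that the entropies at time `k` form a subharmonic
  -- function of the initial state, up to a bounded error.
  have hsub : ∀ x, (entropy (D.walk x k)).toReal
      ≤ ∑ y, D.transition x y * (entropy (D.walk y k)).toReal + (C + L) := by
    intro x
    have h1 : entropy (D.walk x k)
        ≤ ENNReal.ofReal (∑ y, D.transition x y * (entropy (D.walk y k)).toReal + (C + L)) := by
      rw [ENNReal.ofReal_add (Finset.sum_nonneg fun y _ =>
        mul_nonneg (D.transition_nonneg x y) ENNReal.toReal_nonneg) (by positivity),
        ← D.tsum_step_mul_ofReal x _ fun y => ENNReal.toReal_nonneg]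
      refine (entropy_walk_le_entropy_walk_succ_add hD x k).trans ?_
      rw [walk_succ]
      refine (add_le_add (entropy_conv_le _ _) le_rfl).trans ?_
      simp only [ENNReal.ofReal_toReal (hfin _ _)]
      rw [ENNReal.ofReal_add C.coe_nonneg L.coe_nonneg, ENNReal.ofReal_coe_nnreal,
        ENNReal.ofReal_coe_nnreal, hL, add_comm (entropy _), add_assoc]
      exact add_le_add le_rfl (add_le_add (hC x) le_rfl)
    exact ENNReal.toReal_le_of_le_ofReal (add_nonneg (Finset.sum_nonneg fun y _ =>
      mul_nonneg (D.transition_nonneg x y) ENNReal.toReal_nonneg) (by positivity)) h1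
  have h2 := hosc _ _ (by positivity) hsub x y
  rw [← ENNReal.ofReal_toReal (hfin x k), ← ENNReal.ofReal_toReal (hfin y k),
    ENNReal.coe_nnreal_eq, Real.coe_toNNReal _ (by positivity),
    ← ENNReal.ofReal_add ENNReal.toReal_nonneg (by positivity)]
  exact ENNReal.ofReal_le_ofReal h2

/-- A diagram over a finite set whose steps have finite entropy has a well defined asymptotic
entropy. -/
theorem exists_hasAsymptoticEntropy (hD : ∀ x, entropy (D.step x) ≠ ∞) :
    ∃ b : ℝ≥0, D.HasAsymptoticEntropy b := by
  cases isEmpty_or_nonempty Y with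
  | inl h => exact ⟨0, fun θ => (h.false θ.support_nonempty.some.2).elim⟩
  | inr h =>
  obtain ⟨x₀⟩ := h
  obtain ⟨K, hK⟩ := exists_entropy_walk_le_add hD
  have hfin := entropy_walk_ne_top hD
  -- Up to the oscillation bound `K`, the entropies for a fixed initial state are subadditive.
  have hsub : Subadditive fun k => (entropy (D.walk x₀ k)).toReal + K := by
    intro j k
    have h1 : entropy (D.walk x₀ (j + k))
        ≤ entropy (D.walk x₀ j) + (entropy (D.walk x₀ k) + K) := by
      rw [walk_add]
      exact (entropy_conv_le _ _).trans
        (add_le_add le_rfl (tsum_mul_le_of_le _ fun q _ => hK k q.2 x₀))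
    have hk : entropy (D.walk x₀ k) + K ≠ ∞ := ENNReal.add_ne_top.2 ⟨hfin _ _, ENNReal.coe_ne_top⟩
    have h2 := ENNReal.toReal_mono (ENNReal.add_ne_top.2 ⟨hfin _ _, hk⟩) h1
    rw [ENNReal.toReal_add (hfin _ _) hk, ENNReal.toReal_add (hfin _ _) ENNReal.coe_ne_top,
      ENNReal.coe_toReal] at h2
    linarith
  have hlim := hsub.tendsto_lim ⟨0, by
    rintro _ ⟨k, rfl⟩
    positivity⟩
  have hb : 0 ≤ hsub.lim := ge_of_tendsto hlim (Filter.Eventually.of_forall fun k => by positivity)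
  have h0 : Filter.Tendsto (fun k : ℕ => (entropy (D.walk x₀ k) + K) / k) Filter.atTop
      (𝓝 (hsub.lim.toNNReal : ℝ≥0∞)) := by
    refine (ENNReal.tendsto_ofReal hlim).congr' ?_
    filter_upwards [Filter.eventually_gt_atTop 0] with k hk
    rw [ENNReal.ofReal_div_of_pos (by exact_mod_cast hk), ENNReal.ofReal_natCast,
      ENNReal.ofReal_add ENNReal.toReal_nonneg K.coe_nonneg, ENNReal.ofReal_toReal (hfin _ _),
      ENNReal.ofReal_coe_nnreal]
  refine ⟨hsub.lim.toNNReal, fun θ hθ => ?_⟩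
  have h1 : Filter.Tendsto (fun k : ℕ => entropy (D.law θ k) / k) Filter.atTop
      (𝓝 (hsub.lim.toNNReal : ℝ≥0∞)) := by
    refine tendsto_div_natCast_of_le_add (c := entropy θ + 2 * K)
      (ENNReal.add_ne_top.2 ⟨hθ, ENNReal.mul_ne_top (by simp) ENNReal.coe_ne_top⟩)
      (fun k => ?_) (fun k => ?_) h0
    · have h2 := tsum_mul_entropy_le_entropy_conv θ (fun x => D.walk x k) hθ
      rw [← law_eq_conv_walk] at h2
      have h3 : entropy (D.walk x₀ k) ≤ ∑' q, θ q * entropy (D.walk q.2 k) + K := by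
        calc entropy (D.walk x₀ k) = ∑' q, θ q * entropy (D.walk x₀ k) := by
              rw [ENNReal.tsum_mul_right, θ.tsum_coe, one_mul]
          _ ≤ ∑' q, θ q * (entropy (D.walk q.2 k) + K) :=
              ENNReal.tsum_le_tsum fun q => mul_le_mul_right (hK k x₀ q.2) _
          _ = _ := by
              simp only [mul_add]
              rw [ENNReal.tsum_add, ENNReal.tsum_mul_right, θ.tsum_coe, one_mul]
      calc entropy (D.walk x₀ k) + K ≤ entropy (D.law θ k) + K + K :=
            add_le_add (h3.trans (add_le_add h2 le_rfl)) le_rfl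
        _ = entropy (D.law θ k) + 2 * K := by ring
        _ ≤ _ := add_le_add le_rfl le_add_self
    · rw [law_eq_conv_walk]
      refine (entropy_conv_le _ _).trans ?_
      rw [add_comm (entropy θ)]
      refine (add_le_add (tsum_mul_le_of_le _ fun q _ => hK k q.2 x₀) le_rfl).trans ?_
      exact add_le_add le_rfl le_self_add
  refine ⟨h1, tendsto_div_natCast_of_le_add (c := ENNReal.ofReal (Real.log (Nat.card Y)))
    ENNReal.ofReal_ne_top (fun k => ?_) (fun k => ?_) h1⟩
  · exact (entropy_le_entropy_fst_add_entropy_snd _).trans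
      (add_le_add le_rfl (entropy_le_log_natCard _))
  · exact (entropy_map_le _ _).trans le_self_add

end Finite

end Diagram

/-! ### The Poisson equation -/

/-- For an irreducible doubly stochastic matrix `p`, the equation `ψ - p ψ = r` can be solved for
every `r` of mean zero. -/
theorem exists_sub_sum_mul_eq {Y : Type*} [Fintype Y] (p : Y → Y → ℝ) (h0 : ∀ x y, 0 ≤ p x y)
    (h1 : ∀ x, ∑ y, p x y = 1) (h2 : ∀ y, ∑ x, p x y = 1)
    (hirr : ∀ x y, Relation.ReflTransGen (fun a b => p a b ≠ 0) x y)
    (r : Y → ℝ) (hr : ∑ x, r x = 0) : ∃ ψ : Y → ℝ, ∀ x, ψ x - ∑ y, p x y * ψ y = r x := by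
  classical
  cases isEmpty_or_nonempty Y with
  | inl h => exact ⟨0, fun x => h.elim x⟩
  | inr h =>
  have hcard : (Fintype.card Y : ℝ) ≠ 0 := by exact_mod_cast Fintype.card_ne_zero
  -- Adding the sum of all values to `ψ - p ψ` makes this operator injective, hence surjective.
  let T : (Y → ℝ) →ₗ[ℝ] (Y → ℝ) :=
    { toFun := fun f x => f x - ∑ y, p x y * f y + ∑ y, f y
      map_add' := fun f g => by
        funext x
        simp only [Pi.add_apply, mul_add, Finset.sum_add_distrib]
        ring
      map_smul' := fun a f => by
        funext x
        simp only [Pi.smul_apply, smul_eq_mul, RingHom.id_apply, mul_left_comm _ a,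
          ← Finset.mul_sum]
        ring }
  have hsum : ∀ f : Y → ℝ, ∑ x, T f x = Fintype.card Y * ∑ y, f y := by
    intro f
    have h3 : ∑ x, ∑ y, p x y * f y = ∑ y, f y := by
      rw [Finset.sum_comm]
      simp only [← Finset.sum_mul, h2, one_mul]
    show ∑ x, (f x - ∑ y, p x y * f y + ∑ y, f y) = _
    rw [Finset.sum_add_distrib, Finset.sum_sub_distrib, h3, sub_self, zero_add, Finset.sum_const,
      Finset.card_univ, nsmul_eq_mul]
  have hinj : Function.Injective T := by
    rw [injective_iff_map_eq_zero]
    intro f hf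
    have h3 : ∑ y, f y = 0 := by
      have h4 := hsum f
      rw [hf] at h4
      simpa [hcard] using h4.symm
    have h4 : ∀ x, f x = ∑ y, p x y * f y := by
      intro x
      have h5 : f x - ∑ y, p x y * f y + ∑ y, f y = 0 := congrFun hf x
      linarith
    obtain ⟨K, -, hK⟩ := exists_osc_le p h0 h1 hirr
    have h5 : ∀ x y, f x ≤ f y := by
      simpa using hK f 0 le_rfl fun x => by rw [add_zero]; exact (h4 x).le
    funext x
    have h6 : ∑ y, f y = Fintype.card Y * f x := by
      rw [Finset.sum_congr rfl fun y _ => le_antisymm (h5 y x) (h5 x y), Finset.sum_const,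
        Finset.card_univ, nsmul_eq_mul]
    rw [h3] at h6
    simpa [hcard] using h6.symm
  obtain ⟨ψ, hψ⟩ := (LinearMap.injective_iff_surjective.1 hinj) r
  refine ⟨ψ, fun x => ?_⟩
  have h3 := hsum ψ
  rw [hψ, hr] at h3
  have h4 : ∑ y, ψ y = 0 := by simpa [hcard] using h3.symm
  have h5 : ψ x - ∑ y, p x y * ψ y + ∑ y, ψ y = r x := congrFun hψ x
  linarith

theorem map_translate_apply {Γ Y : Type*} [Group Γ] (p : PMF (Γ × Y)) (g h : Γ) (y : Y) :
    (p.map fun r => (g * r.1, r.2)) (h, y) = p (g⁻¹ * h, y) := by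
  conv_lhs => rw [← mul_inv_cancel_left g h]
  exact map_apply_of_injective p (injective_translate g) (g⁻¹ * h, y)

theorem exists_of_conv_ne_zero {Γ X Y : Type*} [Group Γ] {p : PMF (Γ × X)} {κ : X → PMF (Γ × Y)}
    {e : Γ × Y} (he : conv p κ e ≠ 0) : ∃ q r, p q ≠ 0 ∧ κ q.2 r ≠ 0 ∧ r.2 = e.2 := by
  rw [← PMF.mem_support_iff, conv, PMF.mem_support_bind_iff] at he
  obtain ⟨q, hq, he⟩ := he
  rw [PMF.mem_support_map_iff] at he
  obtain ⟨r, hr, rfl⟩ := he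
  exact ⟨q, r, hq, hr, rfl⟩

namespace Diagram

variable {Γ Y : Type*} [Group Γ] (D : Diagram Γ Y) (W : Set Y)

/-! ### Counting and truncating visits to a set -/

open Classical in
/-- The number of visits to `W` that remain to be made after passing through `y`, if `r` of them
remained before; the count stays at `0` once it has got there. -/
noncomputable def countdown (y : Y) (r : ℕ) : ℕ := if y ∈ W then r - 1 else r

theorem countdown_le (y : Y) (r : ℕ) : countdown W y r ≤ r := by
  unfold countdown
  split_ifs
  · exact Nat.sub_le r 1
  · exact le_rfl

theorem countdown_zero (y : Y) : countdown W y 0 = 0 := Nat.le_zero.1 (countdown_le W y 0)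

/-- The law of `(g_K, (y_K, r'))` for the walk started at `(1, x)`, where `r'` is the number of
visits to `W` that are missing at time `K` if `r` visits are required, and `z = (x, r)`. -/
noncomputable def countedWalk : ℕ → Y × ℕ → PMF (Γ × (Y × ℕ))
  | 0, z => PMF.pure (1, z)
  | K + 1, z => conv (D.step z.1) fun y => countedWalk K (y, countdown W y z.2)

theorem map_countedWalk (K : ℕ) (z : Y × ℕ) :
    (countedWalk D W K z).map (Prod.map id Prod.fst) = D.walk z.1 K := by
  induction K generalizing z with
  | zero => rw [countedWalk, PMF.pure_map]; rfl
  | succ K ih =>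
    rw [countedWalk, map_conv, walk_succ]
    simp only [ih]

theorem le_of_countedWalk_ne_zero (K : ℕ) (z : Y × ℕ) (e : Γ × (Y × ℕ))
    (he : countedWalk D W K z e ≠ 0) : e.2.2 ≤ z.2 := by
  induction K generalizing z e with
  | zero =>
    rw [countedWalk, ← PMF.mem_support_iff, PMF.mem_support_pure_iff] at he
    rw [he]
  | succ K ih =>
    obtain ⟨q, r, -, hr, h⟩ := exists_of_conv_ne_zero he
    rw [← h]
    exact (ih _ _ hr).trans (countdown_le W _ _)

open Classical in
/-- The law of the walk started at `(1, x)` and stopped at its first visit to `W` at a positive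
time, or at time `N + 1` if this comes earlier. -/
noncomputable def truncatedTrace : ℕ → Y → PMF (Γ × Y)
  | 0, x => D.step x
  | N + 1, x => conv (D.step x) fun y =>
      if y ∈ W then PMF.pure (1, y) else truncatedTrace N y

theorem truncatedTrace_apply (N : ℕ) (x : Y) (h : Γ) (w : W) :
    truncatedTrace D W N x (h, w.1) = ∑ n ∈ Finset.range (N + 1), D.firstReturn W n x (h, w) := by
  classical
  induction N generalizing x h with
  | zero => simp [truncatedTrace, firstReturn]
  | succ N ih =>
    rw [truncatedTrace, conv, PMF.bind_apply, Finset.sum_range_succ', add_comm]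
    simp only [firstReturn]
    rw [← Summable.tsum_finsetSum (fun _ _ => ENNReal.summable),
      ← tsum_ite_eq ((h, w.1) : Γ × Y) (D.step x), ← ENNReal.tsum_add]
    refine tsum_congr fun p => ?_
    by_cases hp : p.2 ∈ W
    · obtain ⟨g, y⟩ := p
      simp only [if_pos hp, PMF.pure_map, mul_one, PMF.pure_apply, Finset.sum_const_zero,
        add_zero, eq_comm (a := (h, w.1))]
      split_ifs <;> simp
    · have hne : p ≠ (h, w.1) := fun e => hp (e ▸ w.2)
      simp only [if_neg hne, zero_add, if_neg hp]
      rw [map_translate_apply, ih, Finset.mul_sum]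

variable [Finite Y] (hW : W.Nonempty)

/-! ### The first step of the trace -/

section Trace

open Classical in
/-- The first-step decomposition of the trace. -/
theorem traceStep_eq (x : Y) : D.traceStep W hW x = conv (D.step x) fun y =>
    if hy : y ∈ W then PMF.pure (1, ⟨y, hy⟩) else D.traceStep W hW y := by
  ext ⟨h, w⟩
  have hL : D.traceStep W hW x (h, w) = D.step x (h, w.1) + ∑' p : Γ × Y,
      if p.2 ∈ W then 0 else D.step x p * D.traceStep W hW p.2 (p.1⁻¹ * h, w) := by
    show ∑' n, D.firstReturn W n x (h, w) = _
    rw [tsum_eq_zero_add' ENNReal.summable]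
    congr 1
    simp only [firstReturn]
    rw [ENNReal.tsum_comm]
    refine tsum_congr fun p => ?_
    split_ifs
    · simp
    · rw [ENNReal.tsum_mul_left]
      rfl
  rw [hL, conv, PMF.bind_apply, ← tsum_ite_eq ((h, w.1) : Γ × Y) (D.step x), ← ENNReal.tsum_add]
  refine tsum_congr fun p => ?_
  by_cases hp : p.2 ∈ W
  · obtain ⟨g, y⟩ := p
    have hiff : (g, y) = (h, w.1) ↔ (h, w) = (g, (⟨y, hp⟩ : W)) := by
      rw [Prod.mk.injEq, Prod.mk.injEq, ← Subtype.coe_inj]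
      exact ⟨fun e => ⟨e.1.symm, e.2.symm⟩, fun e => ⟨e.1.symm, e.2.symm⟩⟩
    simp only [dif_pos hp, if_pos hp, PMF.pure_map, mul_one, PMF.pure_apply, add_zero, hiff]
    split_ifs <;> simp
  · have hne : p ≠ (h, w.1) := fun e => hp (e ▸ w.2)
    rw [if_neg hne, zero_add, if_neg hp, dif_neg hp, map_translate_apply]

open Classical in
/-- If `T` dominates the expected number of steps, weighted by the entropy `C` of one step, up to
the first visit to `W`, then `T` dominates the entropy of the trace.  By lower semicontinuity
of the entropy, it is enough to bound it for the truncated traces. -/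
theorem entropy_traceStep_le [Fintype Y] {C : ℝ≥0} (hC : ∀ x, entropy (D.step x) ≤ C) (T : Y → ℝ)
    (hT0 : ∀ x, 0 ≤ T x)
    (hT : ∀ x, C + ∑ y, D.transition x y * (if y ∈ W then 0 else T y) ≤ T x) (x : Y) :
    entropy (D.traceStep W hW x) ≤ ENNReal.ofReal (T x) := by
  have hnn : ∀ x, 0 ≤ ∑ y, D.transition x y * (if y ∈ W then 0 else T y) := fun x =>
    Finset.sum_nonneg fun y _ => mul_nonneg (D.transition_nonneg x y) (by
      split_ifs
      · exact le_rfl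
      · exact hT0 y)
  have hN : ∀ N x, entropy (truncatedTrace D W N x) ≤ ENNReal.ofReal (T x) := by
    intro N
    induction N with
    | zero =>
      intro x
      refine (hC x).trans ?_
      rw [ENNReal.coe_nnreal_eq]
      exact ENNReal.ofReal_le_ofReal (by linarith [hT x, hnn x])
    | succ N ih =>
      intro x
      rw [truncatedTrace]
      refine (entropy_conv_le _ _).trans ?_
      refine le_trans ?_ (ENNReal.ofReal_le_ofReal (hT x))
      rw [ENNReal.ofReal_add C.coe_nonneg (hnn x), ENNReal.ofReal_coe_nnreal,
        ← D.tsum_step_mul_ofReal x _ (fun y => by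
          split_ifs
          · exact le_rfl
          · exact hT0 y)]
      refine add_le_add (hC x) (ENNReal.tsum_le_tsum fun q => mul_le_mul_right ?_ _)
      split_ifs
      · rw [entropy_pure]; exact zero_le
      · exact ih q.2
  rw [entropy, ENNReal.tsum_eq_iSup_sum]
  refine iSup_le fun s => ?_
  have hlim : Filter.Tendsto (fun N => ∑ q ∈ s,
      ENNReal.ofReal (Real.negMulLog (truncatedTrace D W N x (q.1, q.2.1)).toReal)) Filter.atTop
      (𝓝 (∑ q ∈ s, ENNReal.ofReal (Real.negMulLog (D.traceStep W hW x q).toReal))) := by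
    refine tendsto_finsetSum s fun q _ => ?_
    refine (ENNReal.continuous_ofReal.tendsto _).comp
      ((Real.continuous_negMulLog.tendsto _).comp
        ((ENNReal.tendsto_toReal (PMF.apply_ne_top _ _)).comp ?_))
    have h1 := (ENNReal.tendsto_nat_tsum fun n => D.firstReturn W n x q).comp
      (Filter.tendsto_add_atTop_nat 1)
    exact h1.congr fun N => (truncatedTrace_apply D W N x q.1 q.2).symm
  refine le_of_tendsto hlim (Filter.Eventually.of_forall fun N => ?_)
  refine (ENNReal.sum_le_tsum s).trans (le_trans ?_ (hN N x))
  have hinj : Function.Injective (fun q : Γ × W => ((q.1, q.2.1) : Γ × Y)) := by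
    rintro ⟨a, b⟩ ⟨c, d⟩ h
    simp only [Prod.mk.injEq] at h
    exact Prod.ext h.1 (Subtype.ext h.2)
  exact ENNReal.tsum_comp_le_tsum_of_injective hinj
    (fun e => ENNReal.ofReal (Real.negMulLog (truncatedTrace D W N x e).toReal))

end Trace

/-! ### The walk at its visits to a set -/

section Visits

/-- The law of the walk started at `(1, x)` at its `r`-th visit to `W` at a positive time. -/
noncomputable def visit : ℕ → Y → PMF (Γ × Y)
  | 0, x => PMF.pure (1, x)
  | r + 1, x => conv (D.traceStep W hW x) fun w => visit r w.1

/-- The recursion for `visit` along single steps of the walk, in place of steps of the trace. -/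
theorem visit_succ (r : ℕ) (x : Y) : visit D W hW (r + 1) x
    = conv (D.step x) fun y => visit D W hW (countdown W y (r + 1)) y := by
  classical
  rw [visit, traceStep_eq, conv_conv]
  congr 1
  funext y
  unfold countdown
  split_ifs
  · rw [pure_conv, Nat.add_sub_cancel]
  · rw [visit]

theorem map_walk_trace (r : ℕ) (w : W) :
    ((D.trace W hW).walk w r).map (Prod.map id Subtype.val) = visit D W hW r w.1 := by
  induction r generalizing w with
  | zero => rw [walk_zero, PMF.pure_map]; rfl
  | succ r ih =>
    rw [walk_succ, map_conv, visit]
    simp only [ih]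
    rfl

theorem entropy_visit_le {C : ℝ≥0} (hC : ∀ x, entropy (D.traceStep W hW x) ≤ C) (r : ℕ) (x : Y) :
    entropy (visit D W hW r x) ≤ r * C := by
  induction r generalizing x with
  | zero => rw [visit, entropy_pure]; exact zero_le
  | succ r ih =>
    rw [visit]
    refine (entropy_conv_le _ _).trans ?_
    rw [Nat.cast_succ, add_mul, one_mul, add_comm]
    exact add_le_add (tsum_mul_le_of_le _ fun q _ => ih q.2.1) (hC x)

/-- The law of `(g_σ, (y_σ, k))` for the walk started at `(1, x)`, where `σ` is the time of the
`r`-th visit to `W` and `k = max (K - σ) 0` is the time left until time `K`. -/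
noncomputable def stoppedWalk : ℕ → Y → ℕ → PMF (Γ × (Y × ℕ))
  | 0, x, r => (visit D W hW r x).map (Prod.map id fun y => (y, 0))
  | K + 1, x, 0 => PMF.pure (1, (x, K + 1))
  | K + 1, x, r + 1 => conv (D.step x) fun y => stoppedWalk K y (countdown W y (r + 1))

theorem map_stoppedWalk (K : ℕ) (x : Y) (r : ℕ) :
    (stoppedWalk D W hW K x r).map (Prod.map id Prod.fst) = visit D W hW r x := by
  induction K generalizing x r with
  | zero =>
    rw [stoppedWalk, PMF.map_comp]
    exact PMF.map_id _
  | succ K ih =>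
    cases r with
    | zero => rw [stoppedWalk, PMF.pure_map]; rfl
    | succ r =>
      rw [stoppedWalk, map_conv, visit_succ]
      simp only [ih]

theorem le_of_stoppedWalk_ne_zero (K : ℕ) (x : Y) (r : ℕ) (e : Γ × (Y × ℕ))
    (he : stoppedWalk D W hW K x r e ≠ 0) : e.2.2 ≤ K := by
  induction K generalizing x r e with
  | zero =>
    rw [stoppedWalk, ← PMF.mem_support_iff, PMF.mem_support_map_iff] at he
    obtain ⟨q, -, rfl⟩ := he
    exact le_rfl
  | succ K ih =>
    cases r with
    | zero =>
      rw [stoppedWalk, ← PMF.mem_support_iff, PMF.mem_support_pure_iff] at he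
      rw [he]
    | succ r =>
      obtain ⟨q, s, -, hs, h⟩ := exists_of_conv_ne_zero he
      rw [← h]
      exact (ih _ _ _ hs).trans (Nat.le_succ K)

/-- Two descriptions of the walk at the later one of the time `K` and the time `σ` of the `r`-th
visit to `W`: as the walk at time `σ` continued until time `K`, and as the walk at time `K`
continued until the `r`-th visit. -/
theorem conv_stoppedWalk_walk (K : ℕ) (x : Y) (r : ℕ) :
    (conv (stoppedWalk D W hW K x r) fun z => D.walk z.1 z.2)
      = conv (countedWalk D W K (x, r)) fun z => visit D W hW z.2 z.1 := by
  induction K generalizing x r with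
  | zero =>
    rw [stoppedWalk, conv_map, countedWalk, pure_conv]
    exact conv_pure _
  | succ K ih =>
    rw [countedWalk, conv_conv]
    simp only [← ih]
    cases r with
    | zero =>
      rw [stoppedWalk, pure_conv, walk_succ]
      congr 1
      funext y
      rw [countdown_zero]
      cases K with
      | zero => rw [stoppedWalk, conv_map]; exact (conv_pure _).symm
      | succ K => rw [stoppedWalk, pure_conv]
    | succ r => rw [stoppedWalk, conv_conv]

/-- A supersolution `F` of the recursion for the expected value of `max (K - σ) 0`, where `σ` is
the time of the `r`-th visit to `W`, bounds this expected value. -/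
theorem tsum_stoppedWalk_mul_le [Fintype Y] (F : ℕ → Y → ℕ → ℝ) (h0 : ∀ K x r, 0 ≤ F K x r)
    (h1 : ∀ K x, K ≤ F K x 0)
    (h2 : ∀ K x r, ∑ y, D.transition x y * F K y (countdown W y (r + 1)) ≤ F (K + 1) x (r + 1))
    (K : ℕ) (x : Y) (r : ℕ) :
    ∑' q, stoppedWalk D W hW K x r q * (q.2.2 : ℝ≥0∞) ≤ ENNReal.ofReal (F K x r) := by
  induction K generalizing x r with
  | zero =>
    rw [stoppedWalk, tsum_map_mul _ _ fun q : Γ × (Y × ℕ) => (q.2.2 : ℝ≥0∞)]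
    simp
  | succ K ih =>
    cases r with
    | zero =>
      rw [stoppedWalk, tsum_pure_mul _ fun q : Γ × (Y × ℕ) => (q.2.2 : ℝ≥0∞),
        ← ENNReal.ofReal_natCast]
      exact ENNReal.ofReal_le_ofReal (h1 (K + 1) x)
    | succ r =>
      rw [stoppedWalk, tsum_conv_mul _ _ fun z : Y × ℕ => (z.2 : ℝ≥0∞)]
      refine le_trans ?_ (ENNReal.ofReal_le_ofReal (h2 K x r))
      rw [← D.tsum_step_mul_ofReal x _ fun y => h0 _ _ _]
      exact ENNReal.tsum_le_tsum fun q => mul_le_mul_right (ih _ _) _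

/-- Comparison of the entropies at time `K` and at the time `σ` of the `r`-th visit to `W`.  The
entropy at time `max K σ` exceeds the one at time `σ` by at most the entropy of the steps
between these times, and it cannot be much smaller than the entropy at time `K`. -/
theorem entropy_walk_le_entropy_visit_add [Fintype Y] {C C' : ℝ≥0}
    (hC : ∀ x, entropy (D.step x) ≤ C) (hC' : ∀ x, entropy (D.traceStep W hW x) ≤ C')
    (K : ℕ) (x : Y) (r : ℕ) :
    entropy (D.walk x K) ≤ entropy (visit D W hW r x)
      + ENNReal.ofReal (Real.log (K + 1)) + ENNReal.ofReal (Real.log (Fintype.card Y * (r + 1)))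
      + C * ∑' q, stoppedWalk D W hW K x r q * (q.2.2 : ℝ≥0∞) := by
  have h1 : entropy (D.walk x K) ≤ entropy (countedWalk D W K (x, r)) := by
    have := entropy_map_le (countedWalk D W K (x, r)) (Prod.map id Prod.fst)
    rwa [map_countedWalk] at this
  have h2 := entropy_le_entropy_conv_add (countedWalk D W K (x, r))
    (fun z => visit D W hW z.2 z.1) (by
      refine ne_top_of_le_ne_top (b := (r : ℝ≥0∞) * C')
        (ENNReal.mul_ne_top (ENNReal.natCast_ne_top r) ENNReal.coe_ne_top)
        (tsum_mul_le_of_le _ fun q hq => (entropy_visit_le D W hW hC' _ _).trans ?_)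
      gcongr
      exact le_of_countedWalk_ne_zero D W K (x, r) q hq)
  have h3 : entropy ((countedWalk D W K (x, r)).map Prod.snd)
      ≤ ENNReal.ofReal (Real.log (Fintype.card Y * (r + 1))) := by
    refine (entropy_le_log_card _ (Finset.univ ×ˢ Finset.range (r + 1)) fun z hz => ?_).trans
      (le_of_eq ?_)
    · rw [← PMF.mem_support_iff, PMF.mem_support_map_iff] at hz
      obtain ⟨q, hq, rfl⟩ := hz
      simpa [Nat.lt_succ_iff] using le_of_countedWalk_ne_zero D W K (x, r) q hq
    · simp [Finset.card_product]
  have h4 : entropy (stoppedWalk D W hW K x r)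
      ≤ entropy (visit D W hW r x) + ENNReal.ofReal (Real.log (K + 1)) := by
    have hinj : Function.Injective fun q : Γ × (Y × ℕ) => ((q.1, q.2.1), q.2.2) := by
      rintro ⟨a, b, c⟩ ⟨a', b', c'⟩ h
      simp only [Prod.mk.injEq] at h
      obtain ⟨⟨rfl, rfl⟩, rfl⟩ := h
      rfl
    rw [← entropy_map_of_injective _ hinj]
    refine (entropy_le_entropy_fst_add_entropy_snd _).trans ?_
    rw [PMF.map_comp, PMF.map_comp]
    refine add_le_add (le_of_eq ?_) ?_
    · rw [← map_stoppedWalk D W hW K x r]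
      rfl
    · refine (entropy_le_log_card _ (Finset.range (K + 1)) fun k hk => ?_).trans
        (le_of_eq (by simp))
      rw [← PMF.mem_support_iff, PMF.mem_support_map_iff] at hk
      obtain ⟨q, hq, rfl⟩ := hk
      exact Finset.mem_range.2 (Nat.lt_succ_of_le (le_of_stoppedWalk_ne_zero D W hW K x r q hq))
  have h5 : ∑' q, stoppedWalk D W hW K x r q * entropy (D.walk q.2.1 q.2.2)
      ≤ C * ∑' q, stoppedWalk D W hW K x r q * (q.2.2 : ℝ≥0∞) := by
    rw [← ENNReal.tsum_mul_left]
    refine ENNReal.tsum_le_tsum fun q => ?_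
    rw [mul_left_comm]
    exact mul_le_mul_right (entropy_walk_le hC _ _) _
  have h6 := entropy_conv_le (stoppedWalk D W hW K x r) fun z => D.walk z.1 z.2
  rw [conv_stoppedWalk_walk] at h6
  calc entropy (D.walk x K) ≤ _ := h1.trans h2
    _ ≤ (entropy (visit D W hW r x) + ENNReal.ofReal (Real.log (K + 1))
          + C * ∑' q, stoppedWalk D W hW K x r q * (q.2.2 : ℝ≥0∞))
        + ENNReal.ofReal (Real.log (Fintype.card Y * (r + 1))) :=
        add_le_add (h6.trans (add_le_add h4 h5)) h3
    _ = _ := by ring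

end Visits

end Diagram

/-! ### Asymptotic entropy of the trace -/

theorem log_le_two_mul_sqrt {u : ℝ} (hu : 0 < u) : Real.log u ≤ 2 * √u := by
  have h := Real.log_le_sub_one_of_pos (Real.sqrt_pos.2 hu)
  rw [Real.log_sqrt hu.le] at h
  linarith

theorem log_le_mul_sqrt {u a i : ℝ} (hu : 0 < u) (ha : 0 ≤ a) (h : u ≤ a * i) :
    Real.log u ≤ 2 * √a * √i := by
  refine (log_le_two_mul_sqrt hu).trans ?_
  rw [mul_assoc, ← Real.sqrt_mul ha]
  have := Real.sqrt_le_sqrt h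
  linarith

theorem tendsto_mul_sqrt_div (A : ℝ≥0) :
    Filter.Tendsto (fun i : ℕ => ENNReal.ofReal (A * √i) / i) Filter.atTop (𝓝 0) := by
  have h1 : Filter.Tendsto (fun i : ℕ => (A : ℝ) * (√(i : ℝ))⁻¹) Filter.atTop (𝓝 0) := by
    have := (tendsto_inv_atTop_zero.comp
      (Real.tendsto_sqrt_atTop.comp (tendsto_natCast_atTop_atTop (R := ℝ)))).const_mul (A : ℝ)
    simpa using this
  have h2 := ENNReal.tendsto_ofReal h1
  rw [ENNReal.ofReal_zero] at h2
  refine h2.congr' ?_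
  filter_upwards [Filter.eventually_gt_atTop 0] with i hi
  have hi' : (0 : ℝ) < i := by exact_mod_cast hi
  rw [← ENNReal.ofReal_natCast i, ← ENNReal.ofReal_div_of_pos hi', mul_div_assoc,
    Real.sqrt_div_self', one_div]

theorem tendsto_comp_mul_div {u : ℕ → ℝ≥0∞} {b : ℝ≥0}
    (hu : Filter.Tendsto (fun k : ℕ => u k / k) Filter.atTop (𝓝 (b : ℝ≥0∞)))
    {N : ℕ} (hN : 0 < N) :
    Filter.Tendsto (fun i : ℕ => u (i * N) / i) Filter.atTop (𝓝 ((N * b : ℝ≥0) : ℝ≥0∞)) := by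
  have h1 := ENNReal.Tendsto.const_mul (a := (N : ℝ≥0∞))
    (hu.comp (Filter.tendsto_id.atTop_mul_const' hN)) (Or.inr (ENNReal.natCast_ne_top N))
  rw [ENNReal.coe_mul, ENNReal.coe_natCast]
  refine h1.congr fun i => ?_
  simp only [Function.comp_apply, id]
  rw [Nat.cast_mul, mul_comm (i : ℝ≥0∞), ← mul_div_assoc,
    ENNReal.mul_div_mul_left _ _ (by exact_mod_cast hN.ne') (ENNReal.natCast_ne_top N)]

namespace Diagram

variable {Γ Y : Type*} [Fintype Y] {D : Diagram Γ Y} {W : Set Y}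

open Classical in
/-- A potential `ψ` with the property that `N_k - κ k - ψ(y_k)` is a martingale, where `N_k` is the
number of visits to `W` up to time `k` and `κ = |W| / |Y|` is the mean number of visits per unit
of time. -/
theorem exists_potential (hcol : ∀ y, ∑ x, D.transition x y = 1) (hW : W.Nonempty) :
    ∃ ψ : Y → ℝ, ∀ x, ∑ y, D.transition x y * (ψ y - if y ∈ W then 1 else 0)
      = ψ x - (W.ncard : ℝ) / Fintype.card Y := by
  have : Nonempty Y := ⟨hW.some⟩
  have hcard : (Fintype.card Y : ℝ) ≠ 0 := by exact_mod_cast Fintype.card_ne_zero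
  obtain ⟨ψ, hψ⟩ := exists_sub_sum_mul_eq D.transition D.transition_nonneg D.sum_transition hcol
    D.transition_irreducible
    (fun x => (W.ncard : ℝ) / Fintype.card Y - ∑ y, D.transition x y * if y ∈ W then 1 else 0) (by
      have h1 : (∑ y, if y ∈ W then (1 : ℝ) else 0) = W.ncard := by
        rw [Finset.sum_boole, Set.ncard_eq_toFinset_card']
        congr 2
        ext y
        simp
      rw [Finset.sum_sub_distrib, Finset.sum_comm]
      simp only [← Finset.sum_mul, hcol, one_mul]
      rw [h1, Finset.sum_const, Finset.card_univ, nsmul_eq_mul, mul_div_cancel₀ _ hcard, sub_self])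
  refine ⟨ψ, fun x => ?_⟩
  have h := hψ x
  simp only [mul_sub, Finset.sum_sub_distrib] at h ⊢
  linarith

theorem exists_forall_abs_le (ψ : Y → ℝ) : ∃ B : ℝ, 0 ≤ B ∧ ∀ x, |ψ x| ≤ B :=
  ⟨∑ x, |ψ x|, Finset.sum_nonneg fun _ _ => abs_nonneg _, fun x =>
    Finset.single_le_sum (f := fun x => |ψ x|) (fun _ _ => abs_nonneg _) (Finset.mem_univ x)⟩

theorem density_pos (hW : W.Nonempty) : 0 < (W.ncard : ℝ) / Fintype.card Y := by
  have : Nonempty Y := ⟨hW.some⟩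
  have h1 : 0 < W.ncard := (Set.ncard_pos W.toFinite).2 hW
  have h2 : 0 < Fintype.card Y := Fintype.card_pos
  positivity

theorem density_le_one : (W.ncard : ℝ) / Fintype.card Y ≤ 1 := by
  refine div_le_one_of_le₀ ?_ (by positivity)
  rw [← Nat.card_eq_fintype_card]
  exact_mod_cast Set.ncard_le_card W

variable [Group Γ]

/-- The trace has steps of finite entropy.  The multiple `C / κ * (ψ + const)` of the potential
dominates the expected number of steps up to the first visit to `W`, weighted by `C`. -/
theorem exists_entropy_traceStep_le (hcol : ∀ y, ∑ x, D.transition x y = 1) (hW : W.Nonempty)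
    {C : ℝ≥0} (hC : ∀ x, entropy (D.step x) ≤ C) :
    ∃ C' : ℝ≥0, ∀ x, entropy (D.traceStep W hW x) ≤ C' := by
  classical
  obtain ⟨ψ, hψ⟩ := exists_potential hcol hW
  obtain ⟨B, -, hψB⟩ := exists_forall_abs_le ψ
  have hκ := density_pos hW
  set κ := (W.ncard : ℝ) / Fintype.card Y
  have hpos : ∀ x, 1 ≤ ψ x + (B + 1) := fun x => by linarith [(abs_le.1 (hψB x)).1]
  have ha : 0 ≤ C / κ := by positivity
  have h := entropy_traceStep_le D W hW hC (fun x => C / κ * (ψ x + (B + 1)))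
    (fun x => mul_nonneg ha (by linarith [hpos x])) (fun x => by
      have h1 : ∑ y, D.transition x y * (if y ∈ W then 0 else C / κ * (ψ y + (B + 1)))
          ≤ ∑ y, (C / κ * (D.transition x y * (ψ y - if y ∈ W then 1 else 0))
            + C / κ * (B + 1) * D.transition x y) := by
        refine Finset.sum_le_sum fun y _ => ?_
        have h2 : (if y ∈ W then 0 else C / κ * (ψ y + (B + 1)))
            ≤ C / κ * (ψ y + (B + 1) - if y ∈ W then 1 else 0) := by
          split_ifs
          · exact mul_nonneg ha (by linarith [hpos y])
          · rw [sub_zero]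
        have h3 := mul_le_mul_of_nonneg_left h2 (D.transition_nonneg x y)
        linarith
      rw [Finset.sum_add_distrib, ← Finset.mul_sum, ← Finset.mul_sum, hψ, D.sum_transition] at h1
      have h2 : C / κ * κ = C := by field_simp
      linarith)
  refine ⟨(C / κ * (B + (B + 1))).toNNReal, fun x => (h x).trans ?_⟩
  exact ENNReal.ofReal_le_ofReal
    (mul_le_mul_of_nonneg_left (by linarith [(abs_le.1 (hψB x)).2]) ha)

/-- The time `σ` of the visit number `i |W|` to `W` is not much earlier than `i |Y|`: the mean value
of `max (i |Y| - σ) 0` is of order at most `√i`. -/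
theorem exists_tsum_stoppedWalk_mul_le (hcol : ∀ y, ∑ x, D.transition x y = 1)
    (hW : W.Nonempty) : ∃ A : ℝ≥0, ∀ i : ℕ, 0 < i → ∀ x,
      ∑' q, stoppedWalk D W hW (i * Fintype.card Y) x (i * W.ncard) q * (q.2.2 : ℝ≥0∞)
        ≤ ENNReal.ofReal (A * √i) := by
  classical
  obtain ⟨ψ, hψ⟩ := exists_potential hcol hW
  obtain ⟨B, hB, hψB⟩ := exists_forall_abs_le ψ
  have hκ := density_pos hW
  have hκ1 := density_le_one (W := W)
  have : Nonempty Y := ⟨hW.some⟩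
  have hcard : (Fintype.card Y : ℝ) ≠ 0 := by exact_mod_cast Fintype.card_ne_zero
  have hκN : (W.ncard : ℝ) / Fintype.card Y * Fintype.card Y = W.ncard :=
    div_mul_cancel₀ _ hcard
  set κ := (W.ncard : ℝ) / Fintype.card Y
  -- The increments of the martingale `r - κ * K + ψ x` are bounded by `1 + 2 * B`.
  set V : ℝ := (1 + 2 * B) ^ 2 with hV
  refine ⟨(κ⁻¹ * (B ^ 2 + V * Fintype.card Y + 1 + 2 * B)).toNNReal, fun i hi x => ?_⟩
  have hi1 : (1 : ℝ) ≤ √i := Real.one_le_sqrt.2 (by exact_mod_cast hi)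
  set s : ℝ := √i with hs
  have hs0 : 0 < s := by linarith
  have hss : s * s = i := Real.mul_self_sqrt (Nat.cast_nonneg i)
  -- The supersolution combines the martingale with its square, which controls the variance.
  set F : ℕ → Y → ℕ → ℝ := fun K x r =>
    κ⁻¹ * (((r - κ * K + ψ x) ^ 2 + V * K) / (2 * s) + s / 2 + B - (r - κ * K + ψ x)) with hF
  have hκi : 0 < κ⁻¹ := inv_pos.2 hκ
  have h0 : ∀ K x r, 0 ≤ F K x r := by
    intro K x r
    refine mul_nonneg hκi.le ?_
    set t := (r - κ * K + ψ x)
    have h1 : t ^ 2 / (2 * s) + s / 2 - t = (t - s) ^ 2 / (2 * s) := by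
      field_simp
      ring
    have h2 : 0 ≤ (t - s) ^ 2 / (2 * s) := by positivity
    have h3 : 0 ≤ V * K / (2 * s) := by positivity
    rw [add_div]
    linarith
  have h1 : ∀ (K : ℕ) x, (K : ℝ) ≤ F K x 0 := by
    intro K x
    have h2 : (K : ℝ) = κ⁻¹ * (κ * K) := by field_simp
    conv_lhs => rw [h2]
    refine mul_le_mul_of_nonneg_left ?_ hκi.le
    have h3 : 0 ≤ (((0 : ℕ) - κ * K + ψ x) ^ 2 + V * K) / (2 * s) := by positivity
    have h4 := (abs_le.1 (hψB x)).2
    push_cast at h3 ⊢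
    linarith
  have h2 : ∀ K x r, ∑ y, D.transition x y * F K y (countdown W y (r + 1))
      ≤ F (K + 1) x (r + 1) := by
    intro K x r
    set t : ℝ := (r + 1 : ℕ) - κ * (K + 1 : ℕ) + ψ x with ht
    set d : Y → ℝ := fun y => κ - ψ x + (ψ y - if y ∈ W then 1 else 0) with hd
    have hm : ∀ y, (countdown W y (r + 1) : ℝ) - κ * K + ψ y = t + d y := by
      intro y
      simp only [ht, hd, countdown]
      by_cases hy : y ∈ W
      · simp only [if_pos hy]
        push_cast
        ring
      · simp only [if_neg hy]
        push_cast
        ring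
    have hd0 : ∑ y, D.transition x y * d y = 0 := by
      simp only [hd]
      rw [Finset.sum_congr rfl fun y _ => mul_add (D.transition x y) _ _, Finset.sum_add_distrib,
        ← Finset.sum_mul, D.sum_transition, hψ]
      ring
    have hd2 : ∑ y, D.transition x y * d y ^ 2 ≤ V := by
      calc ∑ y, D.transition x y * d y ^ 2 ≤ ∑ y, D.transition x y * V := by
            refine Finset.sum_le_sum fun y _ =>
              mul_le_mul_of_nonneg_left ?_ (D.transition_nonneg x y)
            have h3 := abs_le.1 (hψB x)
            have h4 := abs_le.1 (hψB y)
            rw [hV]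
            refine sq_le_sq' ?_ ?_ <;> simp only [hd] <;> split_ifs <;> linarith
        _ = V := by rw [← Finset.sum_mul, D.sum_transition, one_mul]
    have hsum : ∑ y, D.transition x y * F K y (countdown W y (r + 1))
        = κ⁻¹ / (2 * s) * ∑ y, D.transition x y * d y ^ 2
          + κ⁻¹ * (t / s - 1) * ∑ y, D.transition x y * d y
          + κ⁻¹ * ((t ^ 2 + V * K) / (2 * s) + s / 2 + B - t) * ∑ y, D.transition x y := by
      rw [Finset.mul_sum, Finset.mul_sum, Finset.mul_sum, ← Finset.sum_add_distrib,
        ← Finset.sum_add_distrib]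
      refine Finset.sum_congr rfl fun y _ => ?_
      simp only [hF]
      rw [hm]
      field_simp
      ring
    have hR : F (K + 1) x (r + 1) = κ⁻¹ / (2 * s) * V
        + κ⁻¹ * ((t ^ 2 + V * K) / (2 * s) + s / 2 + B - t) := by
      simp only [hF, ← ht]
      push_cast
      field_simp
      ring
    rw [hsum, hd0, D.sum_transition, hR, mul_zero, add_zero, mul_one]
    gcongr
  refine (tsum_stoppedWalk_mul_le D W hW F h0 h1 h2 _ x _).trans (ENNReal.ofReal_le_ofReal ?_)
  rw [Real.coe_toNNReal _ (by positivity), mul_assoc]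
  refine mul_le_mul_of_nonneg_left ?_ hκi.le
  -- At this time and this number of visits the drift of the martingale cancels.
  have h3 : ((i * W.ncard : ℕ) : ℝ) - κ * (i * Fintype.card Y : ℕ) + ψ x = ψ x := by
    push_cast
    rw [← hκN]
    ring
  rw [h3]
  have h4 := abs_le.1 (hψB x)
  have h5 : ψ x ^ 2 ≤ B ^ 2 := sq_le_sq' h4.1 h4.2
  have h6 : (ψ x ^ 2 + V * (i * Fintype.card Y : ℕ)) / (2 * s)
      = ψ x ^ 2 / (2 * s) + V * Fintype.card Y * s / 2 := by
    push_cast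
    rw [← hss]
    field_simp
  have h7 : ψ x ^ 2 / (2 * s) ≤ B ^ 2 * s := by
    rw [div_le_iff₀ (by positivity)]
    have h8 : 1 ≤ s * s := by nlinarith
    nlinarith [mul_le_mul_of_nonneg_left h8 (sq_nonneg B), sq_nonneg B]
  have h8 : 0 ≤ V * Fintype.card Y * s := by positivity
  rw [h6]
  nlinarith

/-- The walk at time `i |Y|` has at most the entropy of the walk at its visit number `i |W|`, up to
an error that is sublinear in `i`. -/
theorem exists_entropy_walk_le_entropy_visit_add (hcol : ∀ y, ∑ x, D.transition x y = 1)
    (hW : W.Nonempty) (hD : ∀ x, entropy (D.step x) ≠ ∞) :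
    ∃ A : ℝ≥0, ∀ i : ℕ, 0 < i → ∀ x, entropy (D.walk x (i * Fintype.card Y))
      ≤ entropy (visit D W hW (i * W.ncard) x) + ENNReal.ofReal (A * √i) := by
  obtain ⟨C, hC⟩ := exists_entropy_step_le hD
  obtain ⟨C', hC'⟩ := exists_entropy_traceStep_le hcol hW hC
  obtain ⟨A, hA⟩ := exists_tsum_stoppedWalk_mul_le hcol hW
  have : Nonempty Y := ⟨hW.some⟩
  have hN : (1 : ℝ) ≤ Fintype.card Y := by exact_mod_cast Fintype.card_pos
  set a₁ : ℝ := Fintype.card Y + 1 with ha₁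
  set a₂ : ℝ := Fintype.card Y * (W.ncard + 1) with ha₂
  refine ⟨(2 * √a₁).toNNReal + (2 * √a₂).toNNReal + C * A, fun i hi x => ?_⟩
  have hi1 : (1 : ℝ) ≤ i := by exact_mod_cast hi
  refine (entropy_walk_le_entropy_visit_add D W hW hC hC' _ x (i * W.ncard)).trans ?_
  rw [add_assoc, add_assoc]
  refine add_le_add le_rfl ?_
  push_cast
  rw [add_mul, add_mul, ENNReal.ofReal_add (by positivity) (by positivity),
    ENNReal.ofReal_add (by positivity) (by positivity), add_assoc,
    Real.coe_toNNReal _ (by positivity), Real.coe_toNNReal _ (by positivity)]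
  refine add_le_add (ENNReal.ofReal_le_ofReal ?_) (add_le_add (ENNReal.ofReal_le_ofReal ?_) ?_)
  · refine log_le_mul_sqrt (by positivity) (by positivity) ?_
    rw [ha₁]
    linarith
  · refine log_le_mul_sqrt (by positivity) (by positivity) ?_
    rw [ha₂, mul_assoc]
    refine mul_le_mul_of_nonneg_left ?_ (by positivity)
    linarith
  · rw [mul_assoc, ENNReal.ofReal_mul C.coe_nonneg, ENNReal.ofReal_coe_nnreal]
    exact mul_le_mul_right (hA i hi x) _

/-- Passing to the trace over `W` speeds up the walk by the factor `|Y| / |W|` on average, and the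
asymptotic entropy grows at least by this factor. -/
theorem card_mul_le_ncard_mul (hcol : ∀ y, ∑ x, D.transition x y = 1)
    (hW : W.Nonempty) (hD : ∀ x, entropy (D.step x) ≠ ∞) {b b' : ℝ≥0}
    (hb : D.HasAsymptoticEntropy b) (hb' : (D.trace W hW).HasAsymptoticEntropy b') :
    Fintype.card Y * b ≤ W.ncard * b' := by
  obtain ⟨A, hA⟩ := exists_entropy_walk_le_entropy_visit_add hcol hW hD
  obtain ⟨w, hw⟩ := id hW
  have : Nonempty Y := ⟨w⟩
  have h1 := tendsto_comp_mul_div (hb (PMF.pure (1, w)) (by rw [entropy_pure]; simp)).1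
    (Fintype.card_pos (α := Y))
  have h2 := tendsto_comp_mul_div
    (hb' (PMF.pure (1, ⟨w, hw⟩)) (by rw [entropy_pure]; simp)).1
    ((Set.ncard_pos W.toFinite).2 hW)
  have h3 := h2.add (tendsto_mul_sqrt_div A)
  rw [add_zero] at h3
  have h4 := le_of_tendsto_of_tendsto h1 h3 (by
    filter_upwards [Filter.eventually_gt_atTop 0] with i hi
    rw [← ENNReal.add_div]
    refine ENNReal.div_le_div_right ((hA i hi w).trans_eq ?_) _
    rw [← map_walk_trace D W hW _ ⟨w, hw⟩, entropy_map_of_injective _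
      (Function.injective_id.prodMap Subtype.val_injective)]
    rfl)
  exact ENNReal.coe_le_coe.1 h4

end Diagram

open TreeAut

variable {m : ℕ → ℕ}

/-! ### Sections and ascension diagrams -/

theorem sec_mul (n : ℕ) (w : Vert m) (hw : w ∈ level m n) (g h : TreeAut m) :
    sec n w hw (g * h) = sec n w hw g * sec n (act w g) (act_mem_level hw g) h := by
  refine ext_act fun v => ?_
  show sectionFun n w hw (g * h) v
    = sectionFun n (act w g) (act_mem_level hw g) h (sectionFun n w hw g v)
  have h1 := concat_sectionFun n w hw (g * h) v
  rw [act_mul, concat_sectionFun, concat_sectionFun] at h1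
  exact (concat_injective h1).symm

theorem sec_one (n : ℕ) (w : Vert m) (hw : w ∈ level m n) : sec n w hw 1 = 1 := by
  have h := sec_mul n w hw 1 1
  rw [one_mul] at h
  exact (left_eq_mul.1 h)

theorem isWord_of_append {w : List ℕ} : ∀ v : List ℕ, IsWord m (v ++ w) → IsWord m w
  | [], h => h
  | _ :: v, h => isWord_of_append v h.2

/-- An automorphism is determined by its action on the first `n` levels and its sections at
the `n`-th level. -/
theorem ext_of_sec {n : ℕ} {g h : TreeAut m}
    (h1 : ∀ w : Vert m, w.1.length ≤ n → act w g = act w h)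
    (h2 : ∀ (w : Vert m) (hw : w ∈ level m n), sec n w hw g = sec n w hw h) : g = h := by
  refine ext_act fun w => ?_
  by_cases hn : w.1.length ≤ n
  · exact h1 w hn
  obtain ⟨l, hl⟩ := w
  obtain ⟨v, u, rfl, hu⟩ : ∃ v u, l = v ++ u ∧ u.length = n :=
    ⟨l.take (l.length - n), l.drop (l.length - n), (List.take_append_drop _ _).symm, by
      simp only at hn
      rw [List.length_drop]
      omega⟩
  have hu' : IsWord m u := isWord_of_append v hl
  have hw : (⟨u, hu'⟩ : Vert m) ∈ level m n := hu
  have h3 := concat_sectionFun n _ hw g ⟨v, (isWord_append hu' hu v).1 hl⟩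
  have h4 := concat_sectionFun n _ hw h ⟨v, (isWord_append hu' hu v).1 hl⟩
  have h5 : sectionFun n ⟨u, hu'⟩ hw g = sectionFun n ⟨u, hu'⟩ hw h :=
    funext fun x => congrArg (fun s => act x s) (h2 _ hw)
  refine h3.trans (Eq.trans ?_ h4.symm)
  rw [h5]
  exact concat_congr _ (h1 _ hu.le) _ _

theorem finite_length_le (m : ℕ → ℕ) (n : ℕ) : Finite {w : Vert m // w.1.length ≤ n} := by
  have : {w : Vert m | w.1.length ≤ n} ⊆ ⋃ k ∈ Finset.range (n + 1), level m k := fun w hw =>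
    Set.mem_biUnion (Finset.mem_coe.2 (Finset.mem_range.2 (Nat.lt_succ_of_le hw))) rfl
  exact (((Finset.range (n + 1)).finite_toSet.biUnion fun k _ => finite_level m k).subset
    this).to_subtype

section Ascension

variable {G : Subgroup (TreeAut m)} {n : ℕ} {O : Set (Vert m)}

/-- The pair `(g|_v, v · g)` for a vertex `v` of a level orbit. -/
def sectionPair (hO : IsLevelOrbit G n O) (v : O) (g : G) : sectionGroup G n × O :=
  (⟨sec n v.1 (hO.subset_level v.2) g,
    Subgroup.subset_closure ⟨g, g.2, v.1, hO.subset_level v.2, rfl⟩⟩,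
   ⟨act v.1 (g : TreeAut m), hO.act_mem v.2 g⟩)

theorem sectionPair_one (hO : IsLevelOrbit G n O) (v : O) : sectionPair hO v 1 = (1, v) :=
  Prod.ext (Subtype.ext (sec_one n v.1 _)) rfl

theorem sectionPair_mul (hO : IsLevelOrbit G n O) (v : O) (g h : G) :
    sectionPair hO v (g * h) =
      ((sectionPair hO v g).1 * (sectionPair hO (sectionPair hO v g).2 h).1,
        (sectionPair hO (sectionPair hO v g).2 h).2) :=
  Prod.ext (Subtype.ext (sec_mul n v.1 _ _ _)) rfl

/-- The sections along the random walk on `G` form a random walk with internal degrees of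
freedom. -/
theorem map_sectionPair_convPow (μ : PMF G) (hμ : Subgroup.closure μ.support = ⊤)
    (hO : IsLevelOrbit G n O) (v : O) (k : ℕ) :
    (convPow μ k).map (sectionPair hO v) = (orbitAscension μ hμ hO).walk v k := by
  induction k with
  | zero => rw [convPow, PMF.pure_map, sectionPair_one]; rfl
  | succ k ih =>
    have h1 : (orbitAscension μ hμ hO).walk v (k + 1)
        = conv ((orbitAscension μ hμ hO).walk v k) fun u => μ.map (sectionPair hO u) := rfl
    rw [h1, ← ih, convPow, conv, PMF.map_bind, PMF.bind_map]
    congr 1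
    funext g
    simp only [Function.comp_apply, PMF.map_comp]
    congr 1
    funext h
    exact sectionPair_mul hO v g h

/-- The transition matrix of an ascension diagram over a full orbit is doubly stochastic. -/
theorem sum_transition_orbitAscension [Fintype O] (μ : PMF G)
    (hμ : Subgroup.closure μ.support = ⊤) (hO : IsLevelOrbit G n O) (w : O) :
    ∑ v, (orbitAscension μ hμ hO).transition v w = 1 := by
  classical
  have h1 : ∀ v, (orbitAscension μ hμ hO).P v w
      = ∑' g, if v = ⟨act w.1 ((g⁻¹ : G) : TreeAut m), hO.act_mem w.2 g⁻¹⟩ then μ g else 0 := by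
    intro v
    have h2 : (orbitAscension μ hμ hO).P v = μ.map (Prod.snd ∘ sectionPair hO v) :=
      PMF.map_comp _ _ _
    rw [h2, PMF.map_apply]
    refine tsum_congr fun g => ?_
    have hiff : w = (Prod.snd ∘ sectionPair hO v) g
        ↔ v = ⟨act w.1 ((g⁻¹ : G) : TreeAut m), hO.act_mem w.2 g⁻¹⟩ := by
      constructor
      · rintro rfl
        exact Subtype.ext (act_inv_act v.1 (g : TreeAut m)).symm
      · rintro rfl
        exact Subtype.ext (act_act_inv w.1 (g : TreeAut m)).symm
    by_cases h : w = (Prod.snd ∘ sectionPair hO v) g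
    · rw [if_pos h, if_pos (hiff.1 h)]
    · rw [if_neg h, if_neg (mt hiff.2 h)]
  have h3 : ∑ v, (orbitAscension μ hμ hO).P v w = 1 := by
    simp only [h1]
    rw [← Summable.tsum_finsetSum fun _ _ => ENNReal.summable]
    simp [μ.tsum_coe]
  simp only [Diagram.transition]
  rw [← ENNReal.toReal_sum fun v _ => PMF.apply_ne_top _ _, h3, ENNReal.toReal_one]

theorem entropy_orbitAscension_step_ne_top {μ : PMF G} (hμ : Subgroup.closure μ.support = ⊤)
    (hH : entropy μ ≠ ∞) (hO : IsLevelOrbit G n O) (v : O) :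
    entropy ((orbitAscension μ hμ hO).step v) ≠ ∞ :=
  ne_top_of_le_ne_top hH (entropy_map_le μ _)

/-- An element of `G` is determined, up to finitely many possibilities, by its sections at
the `n`-th level. -/
theorem exists_entropy_convPow_le {r : ℕ} {O : Fin r → Set (Vert m)} [∀ i, Fintype (O i)]
    (μ : PMF G) (hμ : Subgroup.closure μ.support = ⊤) (hO : ∀ i, IsLevelOrbit G n (O i))
    (hcover : ⋃ i, O i = level m n) : ∃ c : ℝ≥0∞, c ≠ ∞ ∧ ∀ k, entropy (convPow μ k)
      ≤ c + ∑ i, ∑ v, entropy (((orbitAscension μ hμ (hO i)).walk v k).map Prod.fst) := by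
  have := finite_length_le m n
  let L := {w : Vert m // w.1.length ≤ n}
  let F : G → L → L := fun g w => ⟨act w.1 (g : TreeAut m),
    (length_act (g : TreeAut m) w.1.1 w.1.2).trans_le w.2⟩
  let S : (Σ i, O i) → G → sectionGroup G n := fun j g => (sectionPair (hO j.1) j.2 g).1
  refine ⟨ENNReal.ofReal (Real.log (Nat.card (L → L))), ENNReal.ofReal_ne_top, fun k => ?_⟩
  have hinj : Function.Injective fun g : G =>
      (F g, (Finset.univ : Finset (Σ i, O i)).toList.map fun j => S j g) := by
    intro g h hgh
    simp only [Prod.mk.injEq] at hgh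
    refine Subtype.ext (ext_of_sec (n := n) (fun w hw => ?_) fun w hw => ?_)
    · exact congrArg Subtype.val (congrFun hgh.1 ⟨w, hw⟩)
    · obtain ⟨i, hi⟩ := Set.mem_iUnion.1 (hcover.symm ▸ hw)
      exact congrArg Subtype.val
        (List.map_inj_left.1 hgh.2 ⟨i, w, hi⟩ (Finset.mem_toList.2 (Finset.mem_univ _)))
  rw [← entropy_map_of_injective _ hinj]
  refine (entropy_le_entropy_fst_add_entropy_snd _).trans ?_
  rw [PMF.map_comp, PMF.map_comp]
  refine add_le_add (entropy_le_log_natCard _) ((entropy_map_list_map_le _ S _).trans ?_)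
  rw [Finset.sum_map_toList, Finset.sum_sigma']
  refine le_of_eq (Finset.sum_congr rfl fun j _ => ?_)
  rw [← map_sectionPair_convPow, PMF.map_comp]
  rfl

end Ascension

/-- The random walk on `Γ` with step law `μ`, as a diagram over a one-point set. -/
noncomputable def diagramOfPMF {Γ : Type*} (μ : PMF Γ) : Diagram Γ Unit where
  step _ := μ.map fun g => (g, ())
  irreducible _ _ := Relation.ReflTransGen.refl

theorem map_fst_walk_diagramOfPMF {Γ : Type*} [Group Γ] (μ : PMF Γ) (k : ℕ) :
    ((diagramOfPMF μ).walk () k).map Prod.fst = convPow μ k := by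
  induction k with
  | zero => exact PMF.pure_map _ _
  | succ k ih =>
    have h1 : (diagramOfPMF μ).walk () (k + 1)
        = conv ((diagramOfPMF μ).walk () k) fun _ => μ.map fun g => (g, ()) := rfl
    rw [h1, convPow, ← ih, conv, PMF.map_bind, PMF.bind_map]
    simp only [PMF.map_comp]
    rfl

theorem exists_hasAsymptoticEntropy {Γ : Type*} [Group Γ] {μ : PMF Γ} (hμ : entropy μ ≠ ∞) :
    ∃ a : ℝ≥0, HasAsymptoticEntropy μ a := by
  obtain ⟨a, ha⟩ := (diagramOfPMF μ).exists_hasAsymptoticEntropy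
    fun _ => ne_top_of_le_ne_top hμ (entropy_map_le μ _)
  have h := (ha (PMF.pure (1, ())) (by rw [entropy_pure]; simp)).2
  exact ⟨a, h.congr fun k => by rw [← map_fst_walk_diagramOfPMF]; rfl⟩

end RootedTree

theorem mainTheorem4 (m : ℕ → ℕ) (G : Subgroup (RootedTree.TreeAut m)) (μ : PMF G)
    (hgen : Subgroup.closure μ.support = ⊤) (hμ : RootedTree.entropy μ ≠ ∞)
    (n r : ℕ) (O : Fin r → Set (RootedTree.Vert m))
    (hO : ∀ i, RootedTree.IsLevelOrbit G n (O i))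
    (hdisj : Pairwise (Function.onFun Disjoint O))
    (hcover : ⋃ i, O i = RootedTree.level m n)
    (W : ∀ i, Set (O i)) (hW : ∀ i, (W i).Nonempty) :
    ∃ (a : ℝ≥0) (b : Fin r → ℝ≥0),
      RootedTree.HasAsymptoticEntropy μ a ∧
      (∀ i, (RootedTree.ascension μ hgen (hO i) (W i) (hW i)).HasAsymptoticEntropy (b i)) ∧
      a ≤ ∑ i, ((W i).ncard : ℝ≥0) * b i := by
  classical
  have hfin := fun i => (hO i).finite
  have : ∀ i, Fintype (O i) := fun i => Fintype.ofFinite (O i)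
  set D := fun i => RootedTree.orbitAscension μ hgen (hO i) with hD
  have hstep := fun i => RootedTree.entropy_orbitAscension_step_ne_top hgen hμ (hO i)
  have hcol := fun i => RootedTree.sum_transition_orbitAscension μ hgen (hO i)
  obtain ⟨a, ha⟩ := RootedTree.exists_hasAsymptoticEntropy hμ
  choose d hd using fun i => (D i).exists_hasAsymptoticEntropy (hstep i)
  have htrace : ∀ i, ∃ b, ((D i).trace (W i) (hW i)).HasAsymptoticEntropy b := by
    intro i
    obtain ⟨C, hC⟩ := RootedTree.Diagram.exists_entropy_step_le (hstep i)
    obtain ⟨C', hC'⟩ := RootedTree.Diagram.exists_entropy_traceStep_le (hcol i) (hW i) hC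
    exact RootedTree.Diagram.exists_hasAsymptoticEntropy fun w =>
      ne_top_of_le_ne_top ENNReal.coe_ne_top (hC' w.1)
  choose b hb using htrace
  refine ⟨a, b, ha, hb, ?_⟩
  -- The inequality for the full orbits; the traces are compared with these afterwards.
  have h1 : a ≤ ∑ i, ∑ _v : O i, d i := by
    obtain ⟨c, hc, hle⟩ := RootedTree.exists_entropy_convPow_le μ hgen hO hcover
    have h2 := (RootedTree.tendsto_const_div_natCast hc).add
      (tendsto_finsetSum Finset.univ fun i _ => tendsto_finsetSum Finset.univ fun v _ =>
        (hd i (PMF.pure (1, v)) (by rw [RootedTree.entropy_pure]; simp)).2)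
    have h3 := le_of_tendsto_of_tendsto' ha h2 fun k => by
      refine (ENNReal.div_le_div_right (hle k) _).trans (le_of_eq ?_)
      simp only [div_eq_mul_inv, add_mul, Finset.sum_mul]
      rfl
    rw [zero_add] at h3
    exact_mod_cast h3
  refine h1.trans (Finset.sum_le_sum fun i _ => ?_)
  rw [Finset.sum_const, Finset.card_univ, nsmul_eq_mul]
  exact RootedTree.Diagram.card_mul_le_ncard_mul (hcol i) (hW i) (hstep i) (hd i) (hb i)
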